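/- Let $\mathbb T=\mathbb R/\mathbb Z$ and let $\Lambda^{-2}=(1-\partial_x^2)^{-1}$ be the inverse of $\Lambda^2=1-\partial_x^2$ on functions on $\mathbb T$, i.e. the Fourier multiplier with symbol $(1+(2\pi k)^2)^{-1}$, $k\in\mathbb Z$. If $u_0:\mathbb T\to\mathbb R$ is real analytic on $\mathbb T$, then there exist an $\varepsilon>0$ and a unique function $u:(-\varepsilon,\varepsilon)\times\mathbb T\to\mathbb R$ that is (jointly) real analytic in $(t,x)$ on $(-\varepsilon,\varepsilon)\times\mathbb T$ and solves the periodic Cauchy problem for the Novikov equation in nonlocal form $$u_t+u^2u_x=-\Lambda^{-2}\left(3u^2u_x+2u_x^3+3uu_xu_{xx}\right)\quad\text{for } |t|<\varepsilon,\ x\in\mathbb T,\qquad u(0,x)=u_0(x)\quad\text{for } x\in\mathbb T.$$ -/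

import Mathlib

open Set
open scoped Real

noncomputable section

/-- The operator `∂ₓ` on real functions on the circle `𝕋 = ℝ/ℤ`. -/
def circleDeriv (f : UnitAddCircle → ℝ) (x : UnitAddCircle) : ℝ :=
  deriv (fun h : ℝ => f (x + (h : UnitAddCircle))) 0

/-- Real analyticity of a function on the circle `𝕋 = ℝ/ℤ`: analyticity, at every point, in the
coordinate given by the covering `ℝ → ℝ/ℤ`. -/
def CircleAnalytic (f : UnitAddCircle → ℝ) : Prop :=
  AnalyticOnNhd ℝ (fun x : ℝ => f (x : UnitAddCircle)) univ

/-- Joint real analyticity in `(t, x)` of a function on `I × 𝕋`, for a set `I` of times. -/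
def TimeCircleAnalyticOn (u : ℝ → UnitAddCircle → ℝ) (I : Set ℝ) : Prop :=
  AnalyticOnNhd ℝ (fun p : ℝ × ℝ => u p.1 (p.2 : UnitAddCircle)) (I ×ˢ univ)

/-- The operator `Λ⁻² = (1 - ∂ₓ²)⁻¹` on functions on the circle `𝕋 = ℝ/ℤ`, that is, the Fourier
multiplier with symbol `1 / (1 + (2πk)²)`. The series converges absolutely, and its sum is real
because `f` is; the real part only serves to land in `ℝ`. -/
def invLambdaSq (f : UnitAddCircle → ℝ) (x : UnitAddCircle) : ℝ :=
  (∑' k : ℤ, (1 + (2 * (π : ℂ) * (k : ℂ)) ^ 2)⁻¹ *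
    fourierCoeff (fun y : UnitAddCircle => (f y : ℂ)) k * fourier k x).re

/-- The nonlinearity `3u²uₓ + 2uₓ³ + 3u uₓ uₓₓ`. -/
def novikovSource (f : UnitAddCircle → ℝ) (x : UnitAddCircle) : ℝ :=
  3 * f x ^ 2 * circleDeriv f x + 2 * circleDeriv f x ^ 3
    + 3 * f x * circleDeriv f x * circleDeriv (circleDeriv f) x

/-- `u` is a solution, on the time interval `(-ε, ε)`, of the periodic Cauchy problem
`uₜ + u² uₓ = -Λ⁻²(3u²uₓ + 2uₓ³ + 3u uₓ uₓₓ)`, `u(0, x) = u₀(x)`, that is jointly real analytic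
in `t` and `x`. -/
structure IsAnalyticNovikovSolution (u₀ : UnitAddCircle → ℝ) (ε : ℝ)
    (u : ℝ → UnitAddCircle → ℝ) : Prop where
  analytic : TimeCircleAnalyticOn u (Ioo (-ε) ε)
  equation : ∀ t ∈ Ioo (-ε) ε, ∀ x : UnitAddCircle,
    deriv (fun τ : ℝ => u τ x) t + u t x ^ 2 * circleDeriv (u t) x
      = -invLambdaSq (novikovSource (u t)) x
  initial : ∀ x : UnitAddCircle, u 0 x = u₀ x

end

/-!
The solution is built as a power series in time, `u(t, x) = ∑ₙ tⁿ Uₙ(x)`, with `Uₙ` analytic on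
the circle. The equation is equivalent to a recursion that gives `Uₙ₊₁` as `-1 / (n + 1)` times a
cubic expression in `U₀, …, Uₙ` and their derivatives, `novikovCoef`, and the point is a majorant
estimate. The norms `∑ₘ sᵐ sup |f⁽ᵐ⁾| / m!` (`analyticNorm`) are submultiplicative, by the Leibniz
rule, and a derivative costs only the reciprocal of the loss of width: `d ‖f'‖` in the norm of
parameter `s` is at most `‖f‖` in the norm of parameter `s + d`. In the norm `‖f‖ + ‖f'‖`
(`analyticNorm₁`) the right-hand side of the equation loses one derivative and no more, since
`Λ⁻²` gains one. If the loss of width for `Uₗ` is the fraction `1 / (l + 2)` of what is left, then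
the cost is proportional to `l + 1` and is compensated by the factor `1 / (n + 1)`. As
`1 / (n + 1)²` is stable under convolution, the bound `‖Uₙ‖ ≤ M (K / d)ⁿ / (n + 1)²`, with `d` the distance
to the initial width, propagates (`analyticNorm₁_novikovCoef_le`). Expanding each `Uₙ` in its
Taylor series gives a convergent double series, hence joint analyticity.

On lifts to the line, `Λ⁻²` is the integral operator `greenOp` with the explicit Green function of
`1 - ∂ₓ²`. The Fourier multiplier is identified with it through `invLambdaSq_eq_of_helmholtz`: a
periodic `C²` function `w` with `w - w'' = f` has Fourier coefficients `(1 + (2πk)²)⁻¹ f̂(k)`, which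
are summable.

For uniqueness, let `w` be the difference of two solutions. If the time derivatives of `w` of order
less than `n` vanish at `t = 0`, so do those of `wₓ` and `wₓₓ`; all three are then `O(|t|ⁿ)`
uniformly in `x`. The right-hand side is Lipschitz in `(u, uₓ, uₓₓ)` for the supremum norm, so `wₜ` is
`O(|t|ⁿ)`, and `w` vanishes to order `n + 1` (`vanishesToOrder_sub`). Thus `w` vanishes to infinite
order at `t = 0`, and it is zero by the identity theorem in `t`.
-/

noncomputable section

open MeasureTheory

/-! ### The Green operator of `1 - ∂ₓ²` on the circle -/

theorem Function.Periodic.deriv {f : ℝ → ℝ} {c : ℝ} (h : Function.Periodic f c) :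
    Function.Periodic (deriv f) c := fun x => by
  rw [← deriv_comp_add_const, show (fun y => f (y + c)) = f from funext h]

/-- Differentiation under the integral sign against a continuous kernel. -/
theorem hasDerivAt_integral_mul_comp_add {k f : ℝ → ℝ} (hk : Continuous k) (hf : ContDiff ℝ 1 f)
    (x : ℝ) :
    HasDerivAt (fun x => ∫ y in (0 : ℝ)..1, k y * f (x + y))
      (∫ y in (0 : ℝ)..1, k y * deriv f (x + y)) x := by
  have hf' : Continuous (deriv f) := hf.continuous_deriv le_rfl
  have hfc := hf.continuous
  have hK : IsCompact (Icc (x - 1) (x + 1) ×ˢ Icc (0 : ℝ) 1) := isCompact_Icc.prod isCompact_Icc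
  obtain ⟨C, hC⟩ := hK.exists_bound_of_continuousOn
    (f := fun p : ℝ × ℝ => k p.2 * deriv f (p.1 + p.2)) (by fun_prop)
  refine (intervalIntegral.hasDerivAt_integral_of_dominated_loc_of_deriv_le
    (F := fun x y => k y * f (x + y)) (F' := fun x y => k y * deriv f (x + y))
    (bound := fun _ => C) (s := Icc (x - 1) (x + 1)) (Icc_mem_nhds (by linarith) (by linarith))
    (Filter.Eventually.of_forall fun z => ?_) ?_ ?_ ?_ ?_ ?_).2
  · exact (by fun_prop : Continuous fun y => k y * f (z + y)).aestronglyMeasurable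
  · exact (by fun_prop : Continuous fun y => k y * f (x + y)).intervalIntegrable _ _
  · exact (by fun_prop : Continuous fun y => k y * deriv f (x + y)).aestronglyMeasurable
  · refine ae_of_all _ fun y hy z hz => hC (z, y) ⟨hz, ?_⟩
    rw [uIoc_of_le zero_le_one] at hy
    exact ⟨hy.1.le, hy.2⟩
  · exact intervalIntegrable_const
  · refine ae_of_all _ fun y _ z _ => ?_
    have h := ((hf.differentiable one_ne_zero) (z + y)).hasDerivAt
    exact (h.comp_add_const z y).const_mul _

/-- Convolution on the circle with the Green function `cosh (|y| - 1/2) / (2 sinh (1/2))` of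
`1 - ∂ₓ²`, acting on the `1`-periodic lifts of functions. -/
def greenOp (f : ℝ → ℝ) (x : ℝ) : ℝ :=
  (2 * Real.sinh (1 / 2))⁻¹ * ∫ y in (0 : ℝ)..1, Real.cosh (y - 1 / 2) * f (x + y)

theorem sinh_half_pos : 0 < Real.sinh (1 / 2) := Real.sinh_pos_iff.2 (by norm_num)

theorem hasDerivAt_greenOp {f : ℝ → ℝ} (hf : ContDiff ℝ 1 f) (x : ℝ) :
    HasDerivAt (greenOp f) (greenOp (deriv f) x) x :=
  (hasDerivAt_integral_mul_comp_add (by fun_prop) hf x).const_mul _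

theorem deriv_greenOp {f : ℝ → ℝ} (hf : ContDiff ℝ 1 f) :
    deriv (greenOp f) = greenOp (deriv f) :=
  funext fun x => (hasDerivAt_greenOp hf x).deriv

theorem Function.Periodic.greenOp {f : ℝ → ℝ} {c : ℝ} (h : Function.Periodic f c) :
    Function.Periodic (greenOp f) c := fun x => by
  simp only [_root_.greenOp, add_right_comm x c, h _]

theorem contDiff_greenOp {f : ℝ → ℝ} {n : ℕ} (hf : ContDiff ℝ (n + 1) f) :
    ContDiff ℝ n (greenOp f) := by
  induction n generalizing f with
  | zero =>
    have hd : Differentiable ℝ (greenOp f) := fun x =>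
      (hasDerivAt_greenOp (by simpa using hf) x).differentiableAt
    exact contDiff_zero.2 hd.continuous
  | succ n ih =>
    have h1 : ContDiff ℝ 1 f := hf.of_le (by norm_cast; omega)
    push_cast at hf ⊢
    rw [contDiff_succ_iff_deriv]
    refine ⟨fun x => (hasDerivAt_greenOp h1 x).differentiableAt, by simp, ?_⟩
    rw [deriv_greenOp h1]
    exact ih (contDiff_succ_iff_deriv.1 hf).2.2

theorem contDiff_infty_greenOp {f : ℝ → ℝ} (hf : ContDiff ℝ (⊤ : ℕ∞) f) :
    ContDiff ℝ (⊤ : ℕ∞) (greenOp f) :=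
  contDiff_infty.2 fun n => contDiff_greenOp ((contDiff_infty.1 hf) (n + 1))

theorem iteratedDeriv_greenOp {f : ℝ → ℝ} (hf : ContDiff ℝ (⊤ : ℕ∞) f) (m : ℕ) :
    iteratedDeriv m (greenOp f) = greenOp (iteratedDeriv m f) := by
  induction m with
  | zero => simp
  | succ m ih =>
    rw [iteratedDeriv_succ, iteratedDeriv_succ, ih, deriv_greenOp]
    rw [iteratedDeriv_eq_iterate]
    exact ContDiff.iterate_deriv' 1 m (hf.of_le (by exact_mod_cast le_top))

theorem integral_cosh_sub_half :
    ∫ y in (0 : ℝ)..1, Real.cosh (y - 1 / 2) = 2 * Real.sinh (1 / 2) := by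
  rw [intervalIntegral.integral_eq_sub_of_hasDerivAt (f := fun y => Real.sinh (y - 1 / 2))
    (fun x _ => by simpa only [mul_one] using ((hasDerivAt_id' x).sub_const (1 / 2)).sinh)
    ((by fun_prop : Continuous fun y : ℝ => Real.cosh (y - 1 / 2)).intervalIntegrable _ _)]
  rw [show (1 : ℝ) - 1 / 2 = 1 / 2 by norm_num, show (0 : ℝ) - 1 / 2 = -(1 / 2) by norm_num,
    Real.sinh_neg]
  ring

/-- A kernel dominated by `cosh (y - 1/2)` gives, after normalization, an operator of norm at most
one for the supremum norm. -/
theorem abs_integral_kernel_le {k f : ℝ → ℝ} {B : ℝ}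
    (hkc : ∀ y, |k y| ≤ Real.cosh (y - 1 / 2)) (hB : ∀ x, |f x| ≤ B) (x : ℝ) :
    |(2 * Real.sinh (1 / 2))⁻¹ * ∫ y in (0 : ℝ)..1, k y * f (x + y)| ≤ B := by
  have hs := sinh_half_pos
  have h : |∫ y in (0 : ℝ)..1, k y * f (x + y)| ≤ ∫ y in (0 : ℝ)..1, Real.cosh (y - 1 / 2) * B := by
    rw [← Real.norm_eq_abs]
    refine intervalIntegral.norm_integral_le_of_norm_le zero_le_one (ae_of_all _ fun y _ => ?_)
      ((by fun_prop : Continuous fun y : ℝ => Real.cosh (y - 1 / 2) * B).intervalIntegrable _ _)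
    rw [norm_mul]
    exact mul_le_mul (hkc y) (hB _) (norm_nonneg _) (Real.cosh_pos _).le
  rw [intervalIntegral.integral_mul_const, integral_cosh_sub_half] at h
  rw [abs_mul, abs_of_pos (by positivity : 0 < (2 * Real.sinh (1 / 2))⁻¹), inv_mul_le_iff₀
    (by positivity)]
  exact h

theorem abs_greenOp_le {f : ℝ → ℝ} {B : ℝ} (hB : ∀ x, |f x| ≤ B) (x : ℝ) : |greenOp f x| ≤ B :=
  abs_integral_kernel_le (fun _ => (abs_of_pos (Real.cosh_pos _)).le) hB x

/-- Integrating by parts moves the derivative from `f` to the kernel: for periodic `f`, the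
Green operator gains one derivative. -/
theorem greenOp_deriv_eq {f : ℝ → ℝ} (hf : ContDiff ℝ 1 f) (hp : Function.Periodic f 1) (x : ℝ) :
    greenOp (deriv f) x = (2 * Real.sinh (1 / 2))⁻¹ *
      ∫ y in (0 : ℝ)..1, -Real.sinh (y - 1 / 2) * f (x + y) := by
  have hf' : Continuous (deriv f) := hf.continuous_deriv le_rfl
  rw [greenOp, intervalIntegral.integral_mul_deriv_eq_deriv_mul
    (u := fun y => Real.cosh (y - 1 / 2)) (v := fun y => f (x + y))
    (u' := fun y => Real.sinh (y - 1 / 2)) (v' := fun y => deriv f (x + y))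
    (fun y _ => by simpa only [mul_one] using ((hasDerivAt_id' y).sub_const (1 / 2)).cosh)
    (fun y _ => by
      simpa using (((hf.differentiable one_ne_zero) (x + y)).hasDerivAt).comp_const_add x y)
    ((by fun_prop : Continuous fun y : ℝ => Real.sinh (y - 1 / 2)).intervalIntegrable _ _)
    ((by fun_prop : Continuous fun y : ℝ => deriv f (x + y)).intervalIntegrable _ _)]
  congr 1
  have h : f (x + 1) = f x := hp x
  rw [show (1 : ℝ) - 1 / 2 = 1 / 2 by norm_num, show (0 : ℝ) - 1 / 2 = -(1 / 2) by norm_num,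
    Real.cosh_neg, h, add_zero, sub_self, zero_sub]
  simp [intervalIntegral.integral_neg]

theorem abs_deriv_greenOp_le {f : ℝ → ℝ} (hf : ContDiff ℝ 1 f) (hp : Function.Periodic f 1) {B : ℝ}
    (hB : ∀ x, |f x| ≤ B) (x : ℝ) : |deriv (greenOp f) x| ≤ B := by
  rw [deriv_greenOp hf, greenOp_deriv_eq hf hp]
  refine abs_integral_kernel_le (fun y => ?_) hB x
  rw [abs_neg, Real.abs_sinh, ← Real.cosh_abs (y - 1 / 2)]
  exact (Real.sinh_lt_cosh _).le

/-- `greenOp f` solves the Helmholtz equation `w - w'' = f` among periodic functions. -/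
theorem greenOp_sub_deriv_deriv {f : ℝ → ℝ} (hf : ContDiff ℝ 1 f) (hp : Function.Periodic f 1)
    (x : ℝ) : HasDerivAt (deriv (greenOp f)) (greenOp f x - f x) x := by
  have hs := sinh_half_pos
  have hf' : Continuous (deriv f) := hf.continuous_deriv le_rfl
  have h1 : deriv (greenOp f) = fun x => (2 * Real.sinh (1 / 2))⁻¹ *
      ∫ y in (0 : ℝ)..1, -Real.sinh (y - 1 / 2) * f (x + y) := by
    rw [deriv_greenOp hf]; exact funext (greenOp_deriv_eq hf hp)
  rw [h1]
  refine ((hasDerivAt_integral_mul_comp_add (k := fun y => -Real.sinh (y - 1 / 2))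
    (by fun_prop) hf x).const_mul ((2 * Real.sinh (1 / 2))⁻¹)).congr_deriv ?_
  rw [intervalIntegral.integral_mul_deriv_eq_deriv_mul
    (u := fun y => -Real.sinh (y - 1 / 2)) (v := fun y => f (x + y))
    (u' := fun y => -Real.cosh (y - 1 / 2)) (v' := fun y => deriv f (x + y))
    (fun y _ => by simpa only [mul_one] using (((hasDerivAt_id' y).sub_const (1 / 2)).sinh).fun_neg)
    (fun y _ => by
      simpa using (((hf.differentiable one_ne_zero) (x + y)).hasDerivAt).comp_const_add x y)
    ((by fun_prop : Continuous fun y : ℝ => -Real.cosh (y - 1 / 2)).intervalIntegrable _ _)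
    ((by fun_prop : Continuous fun y : ℝ => deriv f (x + y)).intervalIntegrable _ _)]
  have h : f (x + 1) = f x := hp x
  rw [show (1 : ℝ) - 1 / 2 = 1 / 2 by norm_num, show (0 : ℝ) - 1 / 2 = -(1 / 2) by norm_num,
    Real.sinh_neg, h, add_zero, greenOp]
  simp only [neg_mul, intervalIntegral.integral_neg]
  field_simp
  ring

/-! ### Identification of the Fourier multiplier -/

/-- Integration by parts for Fourier coefficients of periodic functions. -/
theorem integral_fourier_mul_deriv {g g' : ℝ → ℝ} (hg : ∀ x, HasDerivAt g (g' x) x)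
    (hg' : Continuous g') (hp : g 1 = g 0) (k : ℤ) :
    ∫ x in (0 : ℝ)..1, fourier (-k) (x : UnitAddCircle) * ((g' x : ℝ) : ℂ) =
      2 * π * Complex.I * k * ∫ x in (0 : ℝ)..1, fourier (-k) (x : UnitAddCircle) * (g x : ℂ) := by
  have hF : Continuous fun x : ℝ => fourier (-k) (x : UnitAddCircle) :=
    (map_continuous _).comp (AddCircle.continuous_mk' 1)
  rw [intervalIntegral.integral_mul_deriv_eq_deriv_mul
    (u := fun x : ℝ => fourier (-k) (x : UnitAddCircle)) (v := fun x => (g x : ℂ))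
    (v' := fun x => (g' x : ℂ)) (fun x _ => hasDerivAt_fourier_neg 1 k x)
    (fun x _ => (hg x).ofReal_comp)
    ((continuous_const.mul hF).intervalIntegrable _ _)
    ((Complex.continuous_ofReal.comp hg').intervalIntegrable _ _)]
  have h1 : ((1 : ℝ) : UnitAddCircle) = ((0 : ℝ) : UnitAddCircle) := by
    rw [AddCircle.coe_period]; rfl
  simp only [h1, hp, sub_self, zero_sub, mul_assoc, intervalIntegral.integral_const_mul]
  simp [mul_assoc]

theorem summable_inv_one_add_sq :
    Summable fun k : ℤ => (1 + (2 * π * (k : ℝ)) ^ 2)⁻¹ := by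
  refine Summable.of_norm_bounded_eventually
    (Real.summable_one_div_int_pow (p := 2) |>.2 (by norm_num)) ?_
  filter_upwards [(Set.finite_singleton (0 : ℤ)).compl_mem_cofinite] with k hk
  have hk : (k : ℝ) ≠ 0 := by simpa using hk
  rw [Real.norm_of_nonneg (by positivity), one_div]
  refine inv_anti₀ (by positivity) ?_
  have : 1 ≤ (2 * π) ^ 2 := by nlinarith [Real.pi_gt_three]
  nlinarith [sq_nonneg (k : ℝ)]

/-- A `C²` function `w` on the circle with `w - w'' = f` is `Λ⁻² f`. -/
theorem invLambdaSq_eq_of_helmholtz {f w : UnitAddCircle → ℝ} {w₁ w₂ : ℝ → ℝ}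
    (h₁ : ∀ x : ℝ, HasDerivAt (fun y : ℝ => w y) (w₁ x) x) (h₂ : ∀ x, HasDerivAt w₁ (w₂ x) x)
    (hc : Continuous w₂) (hp : w₁ 1 = w₁ 0) (hf : ∀ x : ℝ, w x - w₂ x = f x) :
    invLambdaSq f = w := by
  have hwr : Continuous fun y : ℝ => w y :=
    continuous_iff_continuousAt.2 fun x => (h₁ x).continuousAt
  have hwc : Continuous w := by
    refine (QuotientAddGroup.isQuotientMap_mk
      (N := AddSubgroup.zmultiples (1 : ℝ))).continuous_iff.2 hwr
  have hfr : Continuous fun y : ℝ => f y := by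
    simp only [← hf]; exact hwr.sub hc
  have hF : ∀ k : ℤ, Continuous fun x : ℝ => fourier (-k) (x : UnitAddCircle) := fun k =>
    (map_continuous _).comp (AddCircle.continuous_mk' 1)
  have h1 : ((1 : ℝ) : UnitAddCircle) = ((0 : ℝ) : UnitAddCircle) := by
    rw [AddCircle.coe_period]; rfl
  let W : C(UnitAddCircle, ℂ) := ⟨fun x => (w x : ℂ), Complex.continuous_ofReal.comp hwc⟩
  have hcoef : ∀ k : ℤ, fourierCoeff (fun y : UnitAddCircle => (f y : ℂ)) k =
      (1 + (2 * (π : ℂ) * (k : ℂ)) ^ 2) * fourierCoeff W k := by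
    intro k
    have e1 := integral_fourier_mul_deriv h₁
      (continuous_iff_continuousAt.2 fun x => (h₂ x).continuousAt) (by rw [h1]) k
    have e2 := integral_fourier_mul_deriv h₂ hc hp k
    rw [fourierCoeff_eq_intervalIntegral _ _ 0, fourierCoeff_eq_intervalIntegral _ _ 0]
    simp only [← hf, W, ContinuousMap.coe_mk, smul_eq_mul, Complex.ofReal_sub, mul_sub, zero_add,
      div_one, one_smul]
    have i1 : Continuous fun x : ℝ => fourier (-k) (x : UnitAddCircle) * (w x : ℂ) :=
      (hF k).mul (Complex.continuous_ofReal.comp hwr)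
    have i2 : Continuous fun x : ℝ => fourier (-k) (x : UnitAddCircle) * (w₂ x : ℂ) :=
      (hF k).mul (Complex.continuous_ofReal.comp hc)
    rw [intervalIntegral.integral_sub (i1.intervalIntegrable _ _) (i2.intervalIntegrable _ _),
      e2, e1]
    linear_combination (-(2 * (π : ℂ) * k) ^ 2 *
      ∫ x in (0 : ℝ)..1, fourier (-k) (x : UnitAddCircle) * (w x : ℂ)) * Complex.I_sq
  have hne : ∀ k : ℤ, (1 + (2 * (π : ℂ) * (k : ℂ)) ^ 2) ≠ 0 := fun k => by
    have : (1 + (2 * π * (k : ℝ)) ^ 2) ≠ 0 := by positivity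
    exact_mod_cast this
  have hsum : Summable (fourierCoeff W) := by
    obtain ⟨C, hC⟩ := isCompact_Icc.exists_bound_of_continuousOn
      (hfr.continuousOn (s := Icc (0 : ℝ) 1))
    refine Summable.of_norm_bounded (summable_inv_one_add_sq.mul_right C) fun k => ?_
    have e : fourierCoeff W k = (1 + (2 * (π : ℂ) * (k : ℂ)) ^ 2)⁻¹ *
        fourierCoeff (fun y : UnitAddCircle => (f y : ℂ)) k := by
      rw [hcoef, inv_mul_cancel_left₀ (hne k)]
    rw [e, norm_mul, norm_inv]
    have e' : ‖(1 + (2 * (π : ℂ) * (k : ℂ)) ^ 2)‖ = 1 + (2 * π * (k : ℝ)) ^ 2 := by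
      rw [show (1 + (2 * (π : ℂ) * (k : ℂ)) ^ 2) = ((1 + (2 * π * (k : ℝ)) ^ 2 : ℝ) : ℂ) by
        push_cast; rfl, Complex.norm_real, Real.norm_of_nonneg (by positivity)]
    rw [e']
    refine mul_le_mul_of_nonneg_left ?_ (by positivity)
    rw [fourierCoeff_eq_intervalIntegral _ _ 0]
    simp only [zero_add, div_one, one_smul]
    refine (intervalIntegral.norm_integral_le_of_norm_le_const (C := C) fun x hx => ?_).trans
      (by simp)
    rw [uIoc_of_le zero_le_one] at hx
    rw [norm_smul, fourier_apply, Circle.norm_coe, one_mul, Complex.norm_real]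
    exact hC x ⟨hx.1.le, hx.2⟩
  ext x
  have hs := (has_pointwise_sum_fourier_series_of_summable hsum x).tsum_eq
  rw [invLambdaSq]
  simp only [hcoef]
  rw [tsum_congr fun k => by rw [inv_mul_cancel_left₀ (hne k)]]
  simp only [smul_eq_mul] at hs
  rw [hs]
  rfl

theorem invLambdaSq_eq_greenOp {f : UnitAddCircle → ℝ} (hf : ContDiff ℝ 2 fun x : ℝ => f x)
    (x : ℝ) : invLambdaSq f x = greenOp (fun y : ℝ => f y) x := by
  have hf1 : ContDiff ℝ 1 fun x : ℝ => f x := hf.of_le (by norm_num)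
  have hp : Function.Periodic (fun x : ℝ => f x) 1 := fun x => by simp
  have key := invLambdaSq_eq_of_helmholtz (f := f) (w := hp.greenOp.lift)
    (w₁ := deriv (greenOp fun y : ℝ => f y))
    (w₂ := fun x => greenOp (fun y : ℝ => f y) x - f x)
    (fun x => by
      rw [deriv_greenOp hf1]
      exact hasDerivAt_greenOp hf1 x)
    (fun x => greenOp_sub_deriv_deriv hf1 hp x)
    ((contDiff_greenOp (n := 1) (by norm_num; exact hf)).continuous.sub hf.continuous)
    (by have := hp.greenOp.deriv 0; rwa [zero_add] at this)
    (fun x => by simp [Function.Periodic.lift_coe])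
  rw [key, Function.Periodic.lift_coe]

/-! ### Weighted norms of Taylor coefficients -/

section AnalyticNorms

open scoped NNReal ENNReal Nat Topology

theorem ContDiff.infty_deriv {f : ℝ → ℝ} (hf : ContDiff ℝ (⊤ : ℕ∞) f) :
    ContDiff ℝ (⊤ : ℕ∞) (deriv f) :=
  (contDiff_infty_iff_deriv.1 hf).2

theorem ContDiff.infty_iteratedDeriv {f : ℝ → ℝ} (hf : ContDiff ℝ (⊤ : ℕ∞) f) (m : ℕ) :
    ContDiff ℝ (⊤ : ℕ∞) (iteratedDeriv m f) := by
  induction m with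
  | zero => simpa using hf
  | succ m ih => rw [iteratedDeriv_succ]; exact ih.infty_deriv

theorem Function.Periodic.iteratedDeriv {f : ℝ → ℝ} {c : ℝ} (hf : Function.Periodic f c) (m : ℕ) :
    Function.Periodic (iteratedDeriv m f) c := by
  induction m with
  | zero => simpa using hf
  | succ m ih => rw [iteratedDeriv_succ]; exact ih.deriv

/-- The `m`-th Taylor coefficient `f⁽ᵐ⁾(x) / m!` of `f` at `x`. -/
def taylorCoef (m : ℕ) (f : ℝ → ℝ) (x : ℝ) : ℝ := iteratedDeriv m f x / m !

theorem taylorCoef_deriv (m : ℕ) (f : ℝ → ℝ) (x : ℝ) :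
    taylorCoef m (deriv f) x = (m + 1) * taylorCoef (m + 1) f x := by
  rw [taylorCoef, taylorCoef, ← iteratedDeriv_succ', Nat.factorial_succ]
  push_cast
  field_simp

theorem taylorCoef_mul {f g : ℝ → ℝ} (hf : ContDiff ℝ (⊤ : ℕ∞) f) (hg : ContDiff ℝ (⊤ : ℕ∞) g)
    (n : ℕ) (x : ℝ) : taylorCoef n (f * g) x =
      ∑ p ∈ Finset.HasAntidiagonal.antidiagonal n, taylorCoef p.1 f x * taylorCoef p.2 g x := by
  have hn : ((n : ℕ∞) : WithTop ℕ∞) ≤ ((⊤ : ℕ∞) : WithTop ℕ∞) := by exact_mod_cast le_top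
  have h := iteratedDerivWithin_mul (n := n) (mem_univ x) uniqueDiffOn_univ
    (hf.contDiffAt (x := x) |>.contDiffWithinAt |>.of_le hn)
    (hg.contDiffAt (x := x) |>.contDiffWithinAt |>.of_le hn)
  simp only [iteratedDerivWithin_univ] at h
  rw [Finset.Nat.sum_antidiagonal_eq_sum_range_succ
    (fun i j => taylorCoef i f x * taylorCoef j g x), taylorCoef, h, Finset.sum_div]
  refine Finset.sum_congr rfl fun i hi => ?_
  have hi : i ≤ n := Nat.lt_succ_iff.1 (Finset.mem_range.1 hi)
  rw [taylorCoef, taylorCoef, Nat.cast_choose ℝ hi]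
  have := Nat.factorial_pos n
  field_simp

/-- The supremum over the line of the `m`-th Taylor coefficient of `f`. -/
def supTaylor (m : ℕ) (f : ℝ → ℝ) : ℝ≥0∞ := ⨆ x, ‖taylorCoef m f x‖ₑ

theorem enorm_taylorCoef_le (m : ℕ) (f : ℝ → ℝ) (x : ℝ) : ‖taylorCoef m f x‖ₑ ≤ supTaylor m f :=
  le_iSup (fun x => ‖taylorCoef m f x‖ₑ) x

theorem supTaylor_mul_le {f g : ℝ → ℝ} (hf : ContDiff ℝ (⊤ : ℕ∞) f)
    (hg : ContDiff ℝ (⊤ : ℕ∞) g) (n : ℕ) :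
    supTaylor n (f * g) ≤
      ∑ p ∈ Finset.HasAntidiagonal.antidiagonal n, supTaylor p.1 f * supTaylor p.2 g := by
  refine iSup_le fun x => ?_
  rw [taylorCoef_mul hf hg]
  refine (enorm_sum_le _ _).trans (Finset.sum_le_sum fun p _ => ?_)
  rw [enorm_mul]
  exact mul_le_mul' (enorm_taylorCoef_le _ _ _) (enorm_taylorCoef_le _ _ _)

theorem supTaylor_deriv (m : ℕ) (f : ℝ → ℝ) :
    supTaylor m (deriv f) = (m + 1) * supTaylor (m + 1) f := by
  have h : ‖(m : ℝ) + 1‖ₑ = (m : ℝ≥0∞) + 1 := by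
    rw [Real.enorm_of_nonneg (by positivity), ENNReal.ofReal_add (by positivity) zero_le_one]
    simp
  simp only [supTaylor, taylorCoef_deriv, enorm_mul, ENNReal.mul_iSup, h]

/-- The norm `∑ₘ sᵐ sup |f⁽ᵐ⁾| / m!`, a real-variable substitute for the supremum of `f` on a
complex strip of half-width `s`. For smooth periodic `f` it is finite for small `s > 0` exactly
when `f` is analytic. With values in `ℝ≥0∞`, the estimates need no finiteness hypotheses. -/
def analyticNorm (s : ℝ≥0) (f : ℝ → ℝ) : ℝ≥0∞ := ∑' m, (s : ℝ≥0∞) ^ m * supTaylor m f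

theorem analyticNorm_mul_le {f g : ℝ → ℝ} (hf : ContDiff ℝ (⊤ : ℕ∞) f)
    (hg : ContDiff ℝ (⊤ : ℕ∞) g) (s : ℝ≥0) :
    analyticNorm s (f * g) ≤ analyticNorm s f * analyticNorm s g := by
  calc analyticNorm s (f * g)
      ≤ ∑' n, ∑ p ∈ Finset.HasAntidiagonal.antidiagonal n,
          ((s : ℝ≥0∞) ^ p.1 * supTaylor p.1 f) * ((s : ℝ≥0∞) ^ p.2 * supTaylor p.2 g) := by
        refine ENNReal.tsum_le_tsum fun n => ?_
        refine (mul_le_mul_right (supTaylor_mul_le hf hg n) _).trans (le_of_eq ?_)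
        rw [Finset.mul_sum]
        refine Finset.sum_congr rfl fun p hp => ?_
        rw [← Finset.HasAntidiagonal.mem_antidiagonal.1 hp, pow_add]
        ring
    _ = analyticNorm s f * analyticNorm s g := by
        have e : ∀ n, ∑ p ∈ Finset.HasAntidiagonal.antidiagonal n,
            ((s : ℝ≥0∞) ^ p.1 * supTaylor p.1 f) * ((s : ℝ≥0∞) ^ p.2 * supTaylor p.2 g) =
            ∑' p : Finset.HasAntidiagonal.antidiagonal n,
              ((s : ℝ≥0∞) ^ p.1.1 * supTaylor p.1.1 f) * ((s : ℝ≥0∞) ^ p.1.2 * supTaylor p.1.2 g) :=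
          fun n => (Finset.tsum_subtype (Finset.HasAntidiagonal.antidiagonal n) fun p : ℕ × ℕ =>
            ((s : ℝ≥0∞) ^ p.1 * supTaylor p.1 f) * ((s : ℝ≥0∞) ^ p.2 * supTaylor p.2 g)).symm
        rw [tsum_congr e, ← ENNReal.tsum_sigma
            (f := fun n (p : Finset.HasAntidiagonal.antidiagonal n) =>
              ((s : ℝ≥0∞) ^ p.1.1 * supTaylor p.1.1 f) *
              ((s : ℝ≥0∞) ^ p.1.2 * supTaylor p.1.2 g))]
        refine (Finset.HasAntidiagonal.sigmaAntidiagonalEquivProd.tsum_eq (fun p : ℕ × ℕ =>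
          ((s : ℝ≥0∞) ^ p.1 * supTaylor p.1 f) * ((s : ℝ≥0∞) ^ p.2 * supTaylor p.2 g))).trans ?_
        rw [ENNReal.tsum_prod']
        simp only [ENNReal.tsum_mul_left, ENNReal.tsum_mul_right, analyticNorm]

theorem succ_mul_pow_mul_le (s d : ℝ≥0) (m : ℕ) : (m + 1) * s ^ m * d ≤ (s + d) ^ (m + 1) := by
  induction m with
  | zero => simp
  | succ m ih =>
    calc ((m + 1 : ℕ) + 1 : ℝ≥0) * s ^ (m + 1) * d
        = s * ((m + 1) * s ^ m * d) + d * s ^ (m + 1) := by push_cast; ring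
      _ ≤ s * (s + d) ^ (m + 1) + d * (s + d) ^ (m + 1) := by
          gcongr
          exact le_self_add
      _ = (s + d) ^ (m + 1 + 1) := by ring

/-- The Cauchy estimate: a derivative costs the reciprocal of the loss of width. -/
theorem mul_analyticNorm_deriv_le (s d : ℝ≥0) (f : ℝ → ℝ) :
    d * analyticNorm s (deriv f) ≤ analyticNorm (s + d) f := by
  simp only [analyticNorm, supTaylor_deriv]
  rw [← ENNReal.tsum_mul_left]
  refine le_trans (ENNReal.tsum_le_tsum fun m => ?_)
    (ENNReal.tsum_comp_le_tsum_of_injective (add_left_injective 1)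
      (fun m => ((s + d : ℝ≥0) : ℝ≥0∞) ^ m * supTaylor m f))
  have h : ((m : ℝ≥0∞) + 1) * (s : ℝ≥0∞) ^ m * d ≤ ((s + d : ℝ≥0) : ℝ≥0∞) ^ (m + 1) := by
    exact_mod_cast succ_mul_pow_mul_le s d m
  calc (d : ℝ≥0∞) * ((s : ℝ≥0∞) ^ m * ((m + 1) * supTaylor (m + 1) f))
      = (((m : ℝ≥0∞) + 1) * (s : ℝ≥0∞) ^ m * d) * supTaylor (m + 1) f := by ring
    _ ≤ _ := by gcongr

theorem supTaylor_add_le {f g : ℝ → ℝ} (hf : ContDiff ℝ (⊤ : ℕ∞) f)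
    (hg : ContDiff ℝ (⊤ : ℕ∞) g) (m : ℕ) :
    supTaylor m (f + g) ≤ supTaylor m f + supTaylor m g := by
  have hm : ((m : ℕ∞) : WithTop ℕ∞) ≤ ((⊤ : ℕ∞) : WithTop ℕ∞) := by exact_mod_cast le_top
  refine iSup_le fun x => ?_
  have : taylorCoef m (f + g) x = taylorCoef m f x + taylorCoef m g x := by
    rw [taylorCoef, iteratedDeriv_add (hf.contDiffAt.of_le hm) (hg.contDiffAt.of_le hm), add_div]
    rfl
  rw [this]
  exact (enorm_add_le _ _).trans (add_le_add (enorm_taylorCoef_le _ _ _) (enorm_taylorCoef_le _ _ _))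

theorem analyticNorm_add_le {f g : ℝ → ℝ} (hf : ContDiff ℝ (⊤ : ℕ∞) f)
    (hg : ContDiff ℝ (⊤ : ℕ∞) g) (s : ℝ≥0) :
    analyticNorm s (f + g) ≤ analyticNorm s f + analyticNorm s g := by
  rw [analyticNorm, analyticNorm, analyticNorm, ← ENNReal.tsum_add]
  refine ENNReal.tsum_le_tsum fun m => ?_
  rw [← mul_add]
  gcongr
  exact supTaylor_add_le hf hg m

theorem analyticNorm_const_smul (s : ℝ≥0) (c : ℝ) (f : ℝ → ℝ) :
    analyticNorm s (c • f) = ‖c‖ₑ * analyticNorm s f := by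
  have h : ∀ m x, taylorCoef m (c • f) x = c * taylorCoef m f x := fun m x => by
    rw [taylorCoef, iteratedDeriv_const_smul_field, taylorCoef, smul_eq_mul, mul_div_assoc]
  simp only [analyticNorm, supTaylor, h, enorm_mul, ← ENNReal.mul_iSup, ← ENNReal.tsum_mul_left]
  exact tsum_congr fun m => by ring

/-- The norm `‖f‖ + ‖f'‖`, which controls all the factors of the Novikov source but `uₓₓ`. -/
def analyticNorm₁ (s : ℝ≥0) (f : ℝ → ℝ) : ℝ≥0∞ := analyticNorm s f + analyticNorm s (deriv f)

theorem analyticNorm_le_one (s : ℝ≥0) (f : ℝ → ℝ) : analyticNorm s f ≤ analyticNorm₁ s f :=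
  le_self_add

theorem analyticNorm_deriv_le_one (s : ℝ≥0) (f : ℝ → ℝ) :
    analyticNorm s (deriv f) ≤ analyticNorm₁ s f :=
  le_add_self

theorem analyticNorm₁_mul_le {f g : ℝ → ℝ} (hf : ContDiff ℝ (⊤ : ℕ∞) f)
    (hg : ContDiff ℝ (⊤ : ℕ∞) g) (s : ℝ≥0) :
    analyticNorm₁ s (f * g) ≤ analyticNorm₁ s f * analyticNorm₁ s g := by
  have hd : deriv (f * g) = deriv f * g + f * deriv g := funext fun x =>
    deriv_mul ((hf.differentiable (by simp)) x) ((hg.differentiable (by simp)) x)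
  calc analyticNorm₁ s (f * g)
      ≤ analyticNorm s f * analyticNorm s g +
        (analyticNorm s (deriv f) * analyticNorm s g +
          analyticNorm s f * analyticNorm s (deriv g)) := by
        rw [analyticNorm₁, hd]
        gcongr
        · exact analyticNorm_mul_le hf hg s
        · exact (analyticNorm_add_le (hf.infty_deriv.mul hg) (hf.mul hg.infty_deriv) s).trans
            (add_le_add (analyticNorm_mul_le hf.infty_deriv hg s)
              (analyticNorm_mul_le hf hg.infty_deriv s))
    _ ≤ analyticNorm s f * analyticNorm s g +
        (analyticNorm s (deriv f) * analyticNorm s g +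
          analyticNorm s f * analyticNorm s (deriv g)) +
        analyticNorm s (deriv f) * analyticNorm s (deriv g) := le_self_add
    _ = analyticNorm₁ s f * analyticNorm₁ s g := by rw [analyticNorm₁, analyticNorm₁]; ring

theorem mul_analyticNorm₁_deriv_le (s d : ℝ≥0) (f : ℝ → ℝ) :
    d * analyticNorm₁ s (deriv f) ≤ analyticNorm₁ (s + d) f := by
  rw [analyticNorm₁, mul_add]
  exact add_le_add (mul_analyticNorm_deriv_le s d f) (mul_analyticNorm_deriv_le s d _)

theorem analyticNorm₁_add_le {f g : ℝ → ℝ} (hf : ContDiff ℝ (⊤ : ℕ∞) f)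
    (hg : ContDiff ℝ (⊤ : ℕ∞) g) (s : ℝ≥0) :
    analyticNorm₁ s (f + g) ≤ analyticNorm₁ s f + analyticNorm₁ s g := by
  have hd : deriv (f + g) = deriv f + deriv g := funext fun x =>
    deriv_add ((hf.differentiable (by simp)) x) ((hg.differentiable (by simp)) x)
  rw [analyticNorm₁, hd, analyticNorm₁, analyticNorm₁, add_add_add_comm]
  exact add_le_add (analyticNorm_add_le hf hg s)
    (analyticNorm_add_le hf.infty_deriv hg.infty_deriv s)

theorem analyticNorm₁_const_smul (s : ℝ≥0) (c : ℝ) (f : ℝ → ℝ) :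
    analyticNorm₁ s (c • f) = ‖c‖ₑ * analyticNorm₁ s f := by
  have hd : deriv (c • f) = c • deriv f := funext fun x => deriv_const_smul_field c f
  rw [analyticNorm₁, hd, analyticNorm_const_smul, analyticNorm_const_smul, analyticNorm₁, mul_add]

theorem contDiff_infty_sum {ι : Type*} {t : Finset ι} {f : ι → ℝ → ℝ}
    (hf : ∀ i, ContDiff ℝ (⊤ : ℕ∞) (f i)) : ContDiff ℝ (⊤ : ℕ∞) (∑ i ∈ t, f i) := by
  have : (∑ i ∈ t, f i) = fun x => ∑ i ∈ t, f i x := by ext x; simp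
  rw [this]
  exact ContDiff.sum fun i _ => hf i

theorem analyticNorm_zero (s : ℝ≥0) : analyticNorm s 0 = 0 := by
  simpa using analyticNorm_const_smul s 0 0

theorem analyticNorm₁_zero (s : ℝ≥0) : analyticNorm₁ s 0 = 0 := by
  simpa using analyticNorm₁_const_smul s 0 0

theorem analyticNorm_sum_le {ι : Type*} (t : Finset ι) {f : ι → ℝ → ℝ}
    (hf : ∀ i, ContDiff ℝ (⊤ : ℕ∞) (f i)) (s : ℝ≥0) :
    analyticNorm s (∑ i ∈ t, f i) ≤ ∑ i ∈ t, analyticNorm s (f i) := by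
  classical
  induction t using Finset.induction_on with
  | empty => simp [analyticNorm_zero]
  | insert i t hi ih =>
    rw [Finset.sum_insert hi, Finset.sum_insert hi]
    exact (analyticNorm_add_le (hf i) (contDiff_infty_sum hf) s).trans (by gcongr)

theorem analyticNorm₁_sum_le {ι : Type*} (t : Finset ι) {f : ι → ℝ → ℝ}
    (hf : ∀ i, ContDiff ℝ (⊤ : ℕ∞) (f i)) (s : ℝ≥0) :
    analyticNorm₁ s (∑ i ∈ t, f i) ≤ ∑ i ∈ t, analyticNorm₁ s (f i) := by
  classical
  induction t using Finset.induction_on with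
  | empty => simp [analyticNorm₁_zero]
  | insert i t hi ih =>
    rw [Finset.sum_insert hi, Finset.sum_insert hi]
    exact (analyticNorm₁_add_le (hf i) (contDiff_infty_sum hf) s).trans (by gcongr)

theorem iSup_enorm_le_of_abs_le {f g : ℝ → ℝ}
    (h : ∀ B : ℝ, (∀ x, |f x| ≤ B) → ∀ x, |g x| ≤ B) : ⨆ x, ‖g x‖ₑ ≤ ⨆ x, ‖f x‖ₑ := by
  rcases eq_or_ne (⨆ x, ‖f x‖ₑ) ⊤ with ht | ht
  · rw [ht]; exact le_top
  refine iSup_le fun x => ?_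
  rw [← ENNReal.ofReal_toReal ht, Real.enorm_eq_ofReal_abs]
  refine ENNReal.ofReal_le_ofReal (h _ (fun y => ?_) x)
  rw [← ENNReal.ofReal_le_iff_le_toReal ht, ← Real.enorm_eq_ofReal_abs]
  exact le_iSup (fun x => ‖f x‖ₑ) y

theorem supTaylor_eq (m : ℕ) (f : ℝ → ℝ) :
    supTaylor m f = ‖(m ! : ℝ)⁻¹‖ₑ * ⨆ x, ‖iteratedDeriv m f x‖ₑ := by
  simp only [supTaylor, taylorCoef, div_eq_inv_mul, enorm_mul, ENNReal.mul_iSup]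

/-- The Green operator gains one derivative. -/
theorem analyticNorm₁_greenOp_le {f : ℝ → ℝ} (hf : ContDiff ℝ (⊤ : ℕ∞) f)
    (hp : Function.Periodic f 1) (s : ℝ≥0) :
    analyticNorm₁ s (greenOp f) ≤ 2 * analyticNorm s f := by
  have h1 : ∀ m, ContDiff ℝ 1 (iteratedDeriv m f) := fun m =>
    (hf.infty_iteratedDeriv m).of_le (by exact_mod_cast le_top)
  rw [analyticNorm₁, two_mul]
  refine add_le_add (ENNReal.tsum_le_tsum fun m => ?_) (ENNReal.tsum_le_tsum fun m => ?_)
  · rw [supTaylor_eq, supTaylor_eq, iteratedDeriv_greenOp hf]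
    gcongr _ * (_ * ?_)
    exact iSup_enorm_le_of_abs_le fun B hB => abs_greenOp_le hB
  · rw [supTaylor_eq, supTaylor_eq, ← iteratedDeriv_succ', iteratedDeriv_succ,
      iteratedDeriv_greenOp hf]
    gcongr _ * (_ * ?_)
    exact iSup_enorm_le_of_abs_le fun B hB => abs_deriv_greenOp_le (h1 m) (hp.iteratedDeriv m) hB

/-! ### Analytic initial data have finite norm -/

/-- Taylor coefficients of an analytic function are bounded geometrically, uniformly near a
point. -/
theorem exists_taylorCoef_bound_nhds {f : ℝ → ℝ} {x : ℝ} (hf : AnalyticAt ℝ f x) :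
    ∃ t ∈ 𝓝 x, ∃ r : ℝ≥0, 0 < r ∧ ∃ C : ℝ≥0, ∀ y ∈ t, ∀ m, ‖taylorCoef m f y‖₊ * r ^ m ≤ C := by
  obtain ⟨p, ρ, hp⟩ := hf
  obtain ⟨a, ha0, ha⟩ := ENNReal.lt_iff_exists_nnreal_btwn.1 hp.r_pos
  have ha0 : 0 < a := by exact_mod_cast ha0
  have har : ((a / 2 : ℝ≥0) : ℝ≥0∞) + ((a / 2 : ℝ≥0) : ℝ≥0∞) < ρ := by
    rw [← ENNReal.coe_add, add_halves]; exact ha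
  have hs := p.changeOriginSeries_summable_aux₁ (har.trans_le hp.r_le)
  refine ⟨Metric.ball x (a / 2 : ℝ≥0), Metric.ball_mem_nhds _ (by exact_mod_cast half_pos ha0),
    a / 2, half_pos ha0, ∑' s : Σ k l : ℕ, { s : Finset (Fin (k + l)) // s.card = l },
      ‖p (s.1 + s.2.1)‖₊ * (a / 2) ^ s.2.1 * (a / 2) ^ s.1, fun y hy m => ?_⟩
  have hy' : ‖y - x‖₊ ≤ a / 2 := by
    rw [mem_ball_iff_norm] at hy
    exact_mod_cast hy.le
  have hyr : (‖y - x‖₊ : ℝ≥0∞) < ρ :=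
    lt_of_le_of_lt (by exact_mod_cast hy') (lt_of_le_of_lt le_self_add har)
  have hq := hp.changeOrigin hyr
  rw [add_sub_cancel] at hq
  have hc : taylorCoef m f y = p.changeOrigin (y - x) m fun _ => 1 := by
    have := hq.factorial_smul 1 m
    rw [← iteratedDeriv_eq_iteratedFDeriv, nsmul_eq_mul] at this
    rw [taylorCoef, ← this]
    have := Nat.factorial_pos m
    field_simp
  calc ‖taylorCoef m f y‖₊ * (a / 2) ^ m
      ≤ ‖p.changeOrigin (y - x) m‖₊ * (a / 2) ^ m := by
        gcongr
        rw [hc]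
        simpa using (p.changeOrigin (y - x) m).le_opNNNorm fun _ => 1
    _ ≤ (∑' s : Σ l : ℕ, { s : Finset (Fin (m + l)) // s.card = l },
          ‖p (m + s.1)‖₊ * (a / 2) ^ s.1) * (a / 2) ^ m := by
        gcongr
        have hlt : ((a / 2 : ℝ≥0) : ℝ≥0∞) < p.radius :=
          lt_of_le_of_lt le_self_add (har.trans_le hp.r_le)
        refine (p.nnnorm_changeOrigin_le m (hyr.trans_le hp.r_le)).trans ?_
        refine Summable.tsum_le_tsum (fun s => by gcongr) ?_
          (p.changeOriginSeries_summable_aux₂ hlt m)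
        exact p.changeOriginSeries_summable_aux₂ (hyr.trans_le hp.r_le) m
    _ ≤ _ := by
        rw [← NNReal.tsum_mul_right]
        exact NNReal.tsum_comp_le_tsum_of_inj hs (i := Sigma.mk m) sigma_mk_injective

theorem exists_analyticNorm_lt_top {f : ℝ → ℝ} (hf : AnalyticOnNhd ℝ f univ)
    (hp : Function.Periodic f 1) : ∃ s : ℝ≥0, 0 < s ∧ analyticNorm s f < ⊤ := by
  obtain ⟨r, hr, C, hC⟩ : ∃ r : ℝ≥0, 0 < r ∧ ∃ C : ℝ≥0, ∀ y ∈ Icc (0 : ℝ) 1, ∀ m,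
      ‖taylorCoef m f y‖₊ * r ^ m ≤ C := by
    refine isCompact_Icc.induction_on (p := fun K => ∃ r : ℝ≥0, 0 < r ∧ ∃ C : ℝ≥0,
      ∀ y ∈ K, ∀ m, ‖taylorCoef m f y‖₊ * r ^ m ≤ C) ⟨1, one_pos, 0, by simp⟩ ?_ ?_ ?_
    · rintro K K' hK ⟨r, hr, C, h⟩
      exact ⟨r, hr, C, fun y hy => h y (hK hy)⟩
    · rintro K K' ⟨r, hr, C, h⟩ ⟨r', hr', C', h'⟩
      refine ⟨min r r', lt_min hr hr', max C C', fun y hy m => ?_⟩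
      rcases hy with hy | hy
      · refine le_trans ?_ ((h y hy m).trans (le_max_left _ _))
        gcongr
        exact min_le_left _ _
      · refine le_trans ?_ ((h' y hy m).trans (le_max_right _ _))
        gcongr
        exact min_le_right _ _
    · intro x _
      obtain ⟨t, ht, h⟩ := exists_taylorCoef_bound_nhds (hf x (mem_univ x))
      exact ⟨t, mem_nhdsWithin_of_mem_nhds ht, h⟩
  have hall : ∀ y m, ‖taylorCoef m f y‖₊ * r ^ m ≤ C := by
    intro y m
    obtain ⟨z, hz, hzy⟩ := (hp.iteratedDeriv m).exists_mem_Ico₀ one_pos y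
    have := hC z ⟨hz.1, hz.2.le⟩ m
    rwa [taylorCoef, ← hzy, ← taylorCoef] at this
  refine ⟨r / 2, half_pos hr, ?_⟩
  have hterm : ∀ m, ((r / 2 : ℝ≥0) : ℝ≥0∞) ^ m * supTaylor m f ≤ C * (2⁻¹ : ℝ≥0∞) ^ m := by
    intro m
    rw [supTaylor, ENNReal.mul_iSup]
    refine iSup_le fun x => ?_
    have : (r / 2) ^ m * ‖taylorCoef m f x‖₊ ≤ C * 2⁻¹ ^ m := by
      rw [div_eq_mul_inv, mul_pow, mul_right_comm, mul_comm (r ^ m)]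
      gcongr
      exact hall x m
    have h2 : (2⁻¹ : ℝ≥0∞) = ((2⁻¹ : ℝ≥0) : ℝ≥0∞) := by simp
    rw [h2, enorm_eq_nnnorm]
    exact_mod_cast this
  refine lt_of_le_of_lt (ENNReal.tsum_le_tsum hterm) ?_
  rw [ENNReal.tsum_mul_left, ENNReal.tsum_geometric_two]
  exact ENNReal.mul_lt_top ENNReal.coe_lt_top (by simp)

end AnalyticNorms

/-! ### The Taylor coefficients in time -/

section Recursion

open scoped NNReal ENNReal Nat Topology
open Finset.HasAntidiagonal (antidiagonal mem_antidiagonal)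

/-- The sequence with first term `a` produced by a recursion whose step at `n` may use all the
terms of index at most `n`. The step takes a whole sequence; the terms not yet defined are replaced
by `a`. -/
def seqOfStep {α : Type*} (a : α) (step : (ℕ → α) → ℕ → α) : ℕ → α
  | 0 => a
  | n + 1 => step (fun k => if _h : k < n + 1 then seqOfStep a step k else a) n

theorem seqOfStep_succ {α : Type*} {a : α} {step : (ℕ → α) → ℕ → α}
    (h : ∀ n U V, (∀ k ≤ n, U k = V k) → step U n = step V n) (n : ℕ) :
    seqOfStep a step (n + 1) = step (seqOfStep a step) n := by
  rw [seqOfStep]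
  exact h n _ _ fun k hk => dif_pos (Nat.lt_succ_of_le hk)

/-- The `n`-th coefficient of the product of three power series. -/
def cauchyProd₃ {R : Type*} [Semiring R] (a b c : ℕ → R) (n : ℕ) : R :=
  ∑ p ∈ antidiagonal n, ∑ q ∈ antidiagonal p.2, a p.1 * (b q.1 * c q.2)

theorem cauchyProd₃_congr {R : Type*} [Semiring R] {a b c a' b' c' : ℕ → R} {n : ℕ}
    (ha : ∀ k ≤ n, a k = a' k) (hb : ∀ k ≤ n, b k = b' k) (hc : ∀ k ≤ n, c k = c' k) :
    cauchyProd₃ a b c n = cauchyProd₃ a' b' c' n := by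
  refine Finset.sum_congr rfl fun p hp => Finset.sum_congr rfl fun q hq => ?_
  have hp := mem_antidiagonal.1 hp
  have hq := mem_antidiagonal.1 hq
  rw [ha _ (by omega), hb _ (by omega), hc _ (by omega)]

theorem cauchyProd₃_eq {R : Type*} [Semiring R] (a b c : ℕ → R) (n : ℕ) :
    cauchyProd₃ a b c n =
      ∑ p ∈ antidiagonal n, a p.1 * ∑ q ∈ antidiagonal p.2, b q.1 * c q.2 := by
  simp only [cauchyProd₃, Finset.mul_sum]

theorem ContDiff.infty_const_smul {f : ℝ → ℝ} (hf : ContDiff ℝ (⊤ : ℕ∞) f) (c : ℝ) :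
    ContDiff ℝ (⊤ : ℕ∞) (c • f) :=
  ContDiff.const_smul c hf

/-- The coefficients in time of the Novikov source of `∑ₙ tⁿ Uₙ`. -/
def sourceCoef (U : ℕ → ℝ → ℝ) (n : ℕ) : ℝ → ℝ :=
  (3 : ℝ) • cauchyProd₃ U U (fun k => deriv (U k)) n +
    (2 : ℝ) • cauchyProd₃ (fun k => deriv (U k)) (fun k => deriv (U k)) (fun k => deriv (U k)) n +
    (3 : ℝ) • cauchyProd₃ U (fun k => deriv (U k)) (fun k => deriv (deriv (U k))) n

/-- The recursion for the coefficients in time of a solution of the Novikov equation. -/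
def novikovStep (U : ℕ → ℝ → ℝ) (n : ℕ) : ℝ → ℝ :=
  (-((n : ℝ) + 1)⁻¹) •
    (cauchyProd₃ U U (fun k => deriv (U k)) n + greenOp (sourceCoef U n))

theorem novikovStep_congr (n : ℕ) (U V : ℕ → ℝ → ℝ) (h : ∀ k ≤ n, U k = V k) :
    novikovStep U n = novikovStep V n := by
  have h1 : ∀ k ≤ n, deriv (U k) = deriv (V k) := fun k hk => by rw [h k hk]
  have h2 : ∀ k ≤ n, deriv (deriv (U k)) = deriv (deriv (V k)) := fun k hk => by rw [h k hk]
  simp only [novikovStep, sourceCoef, cauchyProd₃_congr h h h1, cauchyProd₃_congr h1 h1 h1,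
    cauchyProd₃_congr h h1 h2]

/-- The Taylor coefficients in time, at `t = 0`, of the solution with initial value `f`. -/
def novikovCoef (f : ℝ → ℝ) : ℕ → ℝ → ℝ := seqOfStep f novikovStep

theorem novikovCoef_zero (f : ℝ → ℝ) : novikovCoef f 0 = f := by
  rw [novikovCoef, seqOfStep]

theorem novikovCoef_succ (f : ℝ → ℝ) (n : ℕ) :
    novikovCoef f (n + 1) = novikovStep (novikovCoef f) n :=
  seqOfStep_succ novikovStep_congr n

theorem contDiff_cauchyProd₃ {f g h : ℕ → ℝ → ℝ} {n : ℕ}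
    (hf : ∀ k ≤ n, ContDiff ℝ (⊤ : ℕ∞) (f k)) (hg : ∀ k ≤ n, ContDiff ℝ (⊤ : ℕ∞) (g k))
    (hh : ∀ k ≤ n, ContDiff ℝ (⊤ : ℕ∞) (h k)) : ContDiff ℝ (⊤ : ℕ∞) (cauchyProd₃ f g h n) := by
  have e : cauchyProd₃ f g h n = fun x => ∑ p ∈ antidiagonal n, ∑ q ∈ antidiagonal p.2,
      f p.1 x * (g q.1 x * h q.2 x) := by
    ext x; simp [cauchyProd₃]
  rw [e]
  refine ContDiff.sum fun p hp => ContDiff.sum fun q hq => ?_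
  have hp := mem_antidiagonal.1 hp
  have hq := mem_antidiagonal.1 hq
  exact (hf _ (by omega)).mul ((hg _ (by omega)).mul (hh _ (by omega)))

theorem periodic_cauchyProd₃ {f g h : ℕ → ℝ → ℝ} {n : ℕ} {c : ℝ}
    (hf : ∀ k ≤ n, Function.Periodic (f k) c) (hg : ∀ k ≤ n, Function.Periodic (g k) c)
    (hh : ∀ k ≤ n, Function.Periodic (h k) c) : Function.Periodic (cauchyProd₃ f g h n) c := by
  intro x
  simp only [cauchyProd₃, Finset.sum_apply, Pi.mul_apply]
  refine Finset.sum_congr rfl fun p hp => Finset.sum_congr rfl fun q hq => ?_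
  have hp := mem_antidiagonal.1 hp
  have hq := mem_antidiagonal.1 hq
  rw [hf _ (by omega) x, hg _ (by omega) x, hh _ (by omega) x]

theorem contDiff_sourceCoef {U : ℕ → ℝ → ℝ} {n : ℕ} (hU : ∀ k ≤ n, ContDiff ℝ (⊤ : ℕ∞) (U k)) :
    ContDiff ℝ (⊤ : ℕ∞) (sourceCoef U n) := by
  have h1 : ∀ k ≤ n, ContDiff ℝ (⊤ : ℕ∞) (deriv (U k)) := fun k hk => (hU k hk).infty_deriv
  have h2 : ∀ k ≤ n, ContDiff ℝ (⊤ : ℕ∞) (deriv (deriv (U k))) := fun k hk => (h1 k hk).infty_deriv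
  exact (((contDiff_cauchyProd₃ hU hU h1).infty_const_smul (3 : ℝ)).add
    ((contDiff_cauchyProd₃ h1 h1 h1).infty_const_smul (2 : ℝ))).add
    ((contDiff_cauchyProd₃ hU h1 h2).infty_const_smul (3 : ℝ))

theorem periodic_sourceCoef {U : ℕ → ℝ → ℝ} {n : ℕ} {c : ℝ}
    (hU : ∀ k ≤ n, Function.Periodic (U k) c) : Function.Periodic (sourceCoef U n) c := by
  have h1 : ∀ k ≤ n, Function.Periodic (deriv (U k)) c := fun k hk => (hU k hk).deriv
  have h2 : ∀ k ≤ n, Function.Periodic (deriv (deriv (U k))) c := fun k hk => (h1 k hk).deriv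
  intro x
  simp only [sourceCoef, Pi.add_apply, Pi.smul_apply, periodic_cauchyProd₃ hU hU h1 x,
    periodic_cauchyProd₃ h1 h1 h1 x, periodic_cauchyProd₃ hU h1 h2 x]

theorem contDiff_novikovCoef {f : ℝ → ℝ} (hf : ContDiff ℝ (⊤ : ℕ∞) f) (n : ℕ) :
    ContDiff ℝ (⊤ : ℕ∞) (novikovCoef f n) := by
  induction n using Nat.strong_induction_on with
  | _ n ih =>
    rcases n with _ | n
    · rwa [novikovCoef_zero]
    · have hU : ∀ k ≤ n, ContDiff ℝ (⊤ : ℕ∞) (novikovCoef f k) :=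
        fun k hk => ih k (Nat.lt_succ_of_le hk)
      rw [novikovCoef_succ]
      exact ((contDiff_cauchyProd₃ hU hU fun k hk => (hU k hk).infty_deriv).add
        (contDiff_infty_greenOp (contDiff_sourceCoef hU))).infty_const_smul _

theorem periodic_novikovCoef {f : ℝ → ℝ} {c : ℝ} (hf : Function.Periodic f c) (n : ℕ) :
    Function.Periodic (novikovCoef f n) c := by
  induction n using Nat.strong_induction_on with
  | _ n ih =>
    rcases n with _ | n
    · rwa [novikovCoef_zero]
    · have hU : ∀ k ≤ n, Function.Periodic (novikovCoef f k) c :=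
        fun k hk => ih k (Nat.lt_succ_of_le hk)
      rw [novikovCoef_succ]
      intro x
      simp only [novikovStep, Pi.smul_apply, Pi.add_apply,
        periodic_cauchyProd₃ hU hU (fun k hk => (hU k hk).deriv) x,
        (periodic_sourceCoef hU).greenOp x]

/-! ### The majorant estimate -/

theorem sum_range_inv_sq_le (n : ℕ) :
    ∑ i ∈ Finset.range (n + 1), ((i + 1 : ℝ) ^ 2)⁻¹ ≤ 2 - (n + 1 : ℝ)⁻¹ := by
  induction n with
  | zero => norm_num
  | succ n ih =>
    rw [Finset.sum_range_succ]
    have h : ((n + 1 : ℕ) + 1 : ℝ)⁻¹ + (((n + 1 : ℕ) + 1 : ℝ) ^ 2)⁻¹ ≤ (n + 1 : ℝ)⁻¹ := by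
      have hn : (0 : ℝ) ≤ n := n.cast_nonneg
      push_cast
      rw [← sub_nonneg]
      have : (n + 1 : ℝ)⁻¹ - ((n + 1 + 1 : ℝ)⁻¹ + ((n + 1 + 1 : ℝ) ^ 2)⁻¹) =
          ((n + 1) * (n + 1 + 1) ^ 2 : ℝ)⁻¹ := by
        field_simp; ring
      rw [this]; positivity
    linarith

/-- The sequence `1 / (n + 1)²` is, up to a constant, stable under convolution. -/
theorem sum_antidiagonal_inv_sq_le (n : ℕ) :
    ∑ p ∈ antidiagonal n, ((p.1 + 1 : ℝ≥0) ^ 2)⁻¹ * ((p.2 + 1 : ℝ≥0) ^ 2)⁻¹ ≤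
      8 * ((n + 1 : ℝ≥0) ^ 2)⁻¹ := by
  rw [← NNReal.coe_le_coe]
  push_cast
  have hle : ∑ i ∈ Finset.range (n + 1), ((i + 1 : ℝ) ^ 2)⁻¹ ≤ 2 :=
    (sum_range_inv_sq_le n).trans (by simp; positivity)
  have h1 : ∑ p ∈ antidiagonal n, ((p.1 + 1 : ℝ) ^ 2)⁻¹ ≤ 2 := by
    rwa [Finset.Nat.sum_antidiagonal_eq_sum_range_succ (fun i _ => ((i + 1 : ℝ) ^ 2)⁻¹)]
  have h2 : ∑ p ∈ antidiagonal n, ((p.2 + 1 : ℝ) ^ 2)⁻¹ ≤ 2 := by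
    rw [← Finset.Nat.sum_antidiagonal_swap]
    exact h1
  calc ∑ p ∈ antidiagonal n, ((p.1 + 1 : ℝ) ^ 2)⁻¹ * ((p.2 + 1 : ℝ) ^ 2)⁻¹
      ≤ ∑ p ∈ antidiagonal n, 2 * ((n + 1 : ℝ) ^ 2)⁻¹ *
          (((p.1 + 1 : ℝ) ^ 2)⁻¹ + ((p.2 + 1 : ℝ) ^ 2)⁻¹) := by
        refine Finset.sum_le_sum fun p hp => ?_
        have hp : (n : ℝ) = p.1 + p.2 := by exact_mod_cast (mem_antidiagonal.1 hp).symm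
        have ha : (0 : ℝ) ≤ p.1 := p.1.cast_nonneg
        have hb : (0 : ℝ) ≤ p.2 := p.2.cast_nonneg
        rw [hp]
        generalize (p.1 : ℝ) = a at *
        generalize (p.2 : ℝ) = b at *
        rw [← sub_nonneg]
        have e : 2 * ((a + b + 1) ^ 2)⁻¹ * (((a + 1) ^ 2)⁻¹ + ((b + 1) ^ 2)⁻¹) -
            ((a + 1) ^ 2)⁻¹ * ((b + 1) ^ 2)⁻¹ =
            (2 * ((a + 1) ^ 2 + (b + 1) ^ 2) - (a + b + 1) ^ 2) /
              ((a + b + 1) ^ 2 * (a + 1) ^ 2 * (b + 1) ^ 2) := by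
          field_simp
          ring
        rw [e]
        exact div_nonneg (by nlinarith [sq_nonneg (a - b)]) (by positivity)
    _ = 2 * ((n + 1 : ℝ) ^ 2)⁻¹ * (∑ p ∈ antidiagonal n, ((p.1 + 1 : ℝ) ^ 2)⁻¹ +
          ∑ p ∈ antidiagonal n, ((p.2 + 1 : ℝ) ^ 2)⁻¹) := by
        rw [← Finset.mul_sum, Finset.sum_add_distrib]
    _ ≤ 2 * ((n + 1 : ℝ) ^ 2)⁻¹ * (2 + 2) := by gcongr
    _ = 8 * ((n + 1 : ℝ) ^ 2)⁻¹ := by ring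

/-- The majorant `M Kⁿ / (n + 1)²` for the coefficients in time. -/
def majorant (M K : ℝ≥0) (n : ℕ) : ℝ≥0 := M * K ^ n * ((n + 1 : ℝ≥0) ^ 2)⁻¹

theorem cauchyProd₃_majorant_le (M K : ℝ≥0) (n : ℕ) :
    cauchyProd₃ (majorant M K) (majorant M K) (majorant M K) n ≤
      256 * M ^ 2 * (M * K ^ n * (((n + 1 : ℕ) + 1 : ℝ≥0) ^ 2)⁻¹) := by
  have h2 : ∀ n, ∑ q ∈ antidiagonal n, majorant M K q.1 * majorant M K q.2 ≤
      8 * M * majorant M K n := fun n => by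
    calc ∑ q ∈ antidiagonal n, majorant M K q.1 * majorant M K q.2
        = M ^ 2 * K ^ n *
            ∑ p ∈ antidiagonal n, ((p.1 + 1 : ℝ≥0) ^ 2)⁻¹ * ((p.2 + 1 : ℝ≥0) ^ 2)⁻¹ := by
          rw [Finset.mul_sum]
          refine Finset.sum_congr rfl fun p hp => ?_
          rw [← mem_antidiagonal.1 hp, pow_add, majorant, majorant]
          ring
      _ ≤ M ^ 2 * K ^ n * (8 * ((n + 1 : ℝ≥0) ^ 2)⁻¹) := by
          gcongr; exact sum_antidiagonal_inv_sq_le n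
      _ = 8 * M * majorant M K n := by rw [majorant]; ring
  have h4 : ((n + 1 : ℝ≥0) ^ 2)⁻¹ ≤ 4 * (((n + 1 : ℕ) + 1 : ℝ≥0) ^ 2)⁻¹ := by
    rw [← div_eq_mul_inv, le_div_iff₀ (by positivity), inv_mul_le_iff₀ (by positivity)]
    push_cast
    calc ((n : ℝ≥0) + 1 + 1) ^ 2 ≤ (2 * ((n : ℝ≥0) + 1)) ^ 2 := by
          gcongr
          rw [two_mul]
          gcongr
          exact le_add_self
      _ = ((n : ℝ≥0) + 1) ^ 2 * 4 := by ring
  calc cauchyProd₃ (majorant M K) (majorant M K) (majorant M K) n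
      ≤ ∑ p ∈ antidiagonal n, majorant M K p.1 * (8 * M * majorant M K p.2) := by
        rw [cauchyProd₃_eq]
        gcongr with p
        exact h2 _
    _ = 8 * M * ∑ p ∈ antidiagonal n, majorant M K p.1 * majorant M K p.2 := by
        rw [Finset.mul_sum]
        exact Finset.sum_congr rfl fun p _ => by ring
    _ ≤ 8 * M * (8 * M * majorant M K n) := by gcongr; exact h2 n
    _ ≤ 8 * M * (8 * M * (M * K ^ n * (4 * (((n + 1 : ℕ) + 1 : ℝ≥0) ^ 2)⁻¹))) := by
        rw [majorant]; gcongr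
    _ = _ := by ring

/-- A subadditive and submultiplicative functional of a triple Cauchy product is at most the
triple Cauchy product of majorants. The constant `D` is carried by the last factor. -/
theorem norm_cauchyProd₃_le {N : (ℝ → ℝ) → ℝ≥0∞}
    (hsum : ∀ (t : Finset (ℕ × ℕ)) (f : ℕ × ℕ → ℝ → ℝ), (∀ i, ContDiff ℝ (⊤ : ℕ∞) (f i)) →
      N (∑ i ∈ t, f i) ≤ ∑ i ∈ t, N (f i))
    (hmul : ∀ f g : ℝ → ℝ, ContDiff ℝ (⊤ : ℕ∞) f → ContDiff ℝ (⊤ : ℕ∞) g →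
      N (f * g) ≤ N f * N g)
    {f g h : ℕ → ℝ → ℝ} (hf : ∀ k, ContDiff ℝ (⊤ : ℕ∞) (f k))
    (hg : ∀ k, ContDiff ℝ (⊤ : ℕ∞) (g k)) (hh : ∀ k, ContDiff ℝ (⊤ : ℕ∞) (h k))
    {a b c : ℕ → ℝ≥0} {D : ℝ≥0} {n : ℕ} (ha : ∀ k ≤ n, N (f k) ≤ a k)
    (hb : ∀ k ≤ n, N (g k) ≤ b k) (hc : ∀ k ≤ n, N (h k) ≤ (D * c k : ℝ≥0)) :
    N (cauchyProd₃ f g h n) ≤ (D * cauchyProd₃ a b c n : ℝ≥0) := by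
  rw [cauchyProd₃]
  refine (hsum _ _ fun p => contDiff_infty_sum fun q =>
    (hf _).mul ((hg _).mul (hh _))).trans ?_
  rw [cauchyProd₃, Finset.mul_sum, ENNReal.ofNNReal_finsetSum]
  refine Finset.sum_le_sum fun p hp => ?_
  refine (hsum _ _ fun q => (hf _).mul ((hg _).mul (hh _))).trans ?_
  rw [Finset.mul_sum, ENNReal.ofNNReal_finsetSum]
  refine Finset.sum_le_sum fun q hq => ?_
  have hp := mem_antidiagonal.1 hp
  have hq := mem_antidiagonal.1 hq
  calc N (f p.1 * (g q.1 * h q.2)) ≤ N (f p.1) * (N (g q.1) * N (h q.2)) :=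
        (hmul _ _ (hf _) ((hg _).mul (hh _))).trans (mul_le_mul_right (hmul _ _ (hg _) (hh _)) _)
    _ ≤ a p.1 * (b q.1 * (D * c q.2 : ℝ≥0)) := by
        gcongr
        · exact ha _ (by omega)
        · exact hb _ (by omega)
        · exact hc _ (by omega)
    _ = ((D * (a p.1 * (b q.1 * c q.2)) : ℝ≥0) : ℝ≥0∞) := by push_cast; ring

theorem analyticNorm_mono {s s' : ℝ≥0} (h : s ≤ s') (f : ℝ → ℝ) :
    analyticNorm s f ≤ analyticNorm s' f :=
  ENNReal.tsum_le_tsum fun m => by gcongr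

theorem analyticNorm₁_mono {s s' : ℝ≥0} (h : s ≤ s') (f : ℝ → ℝ) :
    analyticNorm₁ s f ≤ analyticNorm₁ s' f :=
  add_le_add (analyticNorm_mono h f) (analyticNorm_mono h _)

theorem succ_div_pow_le_three (l : ℕ) : ((l + 2 : ℝ≥0) / (l + 1)) ^ l ≤ 3 := by
  rw [← NNReal.coe_le_coe]
  push_cast
  have hl : (0 : ℝ) < l + 1 := by positivity
  calc ((l + 2 : ℝ) / (l + 1)) ^ l ≤ Real.exp (1 / (l + 1)) ^ l := by
        gcongr
        refine le_trans (le_of_eq ?_) (Real.add_one_le_exp _)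
        field_simp
        ring
    _ = Real.exp (l / (l + 1)) := by rw [← Real.exp_nat_mul, mul_one_div]
    _ ≤ Real.exp 1 := Real.exp_le_exp.2 (by rw [div_le_one hl]; linarith)
    _ ≤ 3 := by linarith [Real.exp_one_lt_d9]

/-- The derivative estimate on the majorants: the loss of width is taken to be the fraction
`1 / (l + 2)` of the width that is left, and the cost is a factor proportional to `l + 1`, which
the time integration in the recursion compensates. -/
theorem analyticNorm₁_deriv_le_of_majorant {f : ℝ → ℝ} {δ M K : ℝ≥0} {l : ℕ}
    (h : ∀ s d : ℝ≥0, 0 < d → s + d = δ → analyticNorm₁ s f ≤ majorant M (K / d) l)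
    {s d : ℝ≥0} (hd : 0 < d) (hsd : s + d = δ) :
    analyticNorm₁ s (deriv f) ≤ (6 * (l + 1) / d * majorant M (K / d) l : ℝ≥0) := by
  have hsplit : d / (l + 2) + d * ((l + 1) / (l + 2)) = d := by
    have : (l + 2 : ℝ≥0) ≠ 0 := by positivity
    field_simp
    ring
  have h1 := (mul_analyticNorm₁_deriv_le s (d / (l + 2)) f).trans
    (h (s + d / (l + 2)) (d * ((l + 1) / (l + 2))) (by positivity)
      (by rw [add_assoc, hsplit, hsd]))
  have hd2 : d / (l + 2) ≠ 0 := by positivity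
  rw [mul_comm, ← ENNReal.le_div_iff_mul_le (.inl (by exact_mod_cast hd2))
      (.inl ENNReal.coe_ne_top),
    ← ENNReal.coe_div hd2] at h1
  refine h1.trans (ENNReal.coe_le_coe.2 ?_)
  calc majorant M (K / (d * ((l + 1) / (l + 2)))) l / (d / (l + 2))
      = (l + 2) / d * ((l + 2) / (l + 1)) ^ l * majorant M (K / d) l := by
        have e : K / (d * ((l + 1) / (l + 2))) = K / d * ((l + 2) / (l + 1)) := by
          field_simp
        rw [majorant, majorant, e, mul_pow]
        field_simp
    _ ≤ (2 * (l + 1)) / d * 3 * majorant M (K / d) l := by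
        gcongr
        · rw [two_mul]
          calc (l : ℝ≥0) + 2 = (l + 1) + 1 := by ring
            _ ≤ (l + 1) + (l + 1) := by gcongr; exact le_add_self
        · exact succ_div_pow_le_three l
    _ = _ := by ring

/-- The majorant estimate for the coefficients in time, on every strip narrower than the one of
the initial value. -/
theorem analyticNorm₁_novikovCoef_le {f : ℝ → ℝ} (hf : ContDiff ℝ (⊤ : ℕ∞) f)
    (hp : Function.Periodic f 1) {δ M : ℝ≥0} (hδ : δ ≤ 1) (h0 : analyticNorm₁ δ f ≤ M) (n : ℕ) :
    ∀ s d : ℝ≥0, 0 < d → s + d = δ →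
      analyticNorm₁ s (novikovCoef f n) ≤ majorant M (13312 * M ^ 2 / d) n := by
  induction n using Nat.strong_induction_on with
  | _ n ih =>
  intro s d hd hsd
  rcases n with _ | n
  · rw [novikovCoef_zero]
    refine (analyticNorm₁_mono (hsd ▸ le_self_add) f).trans (h0.trans ?_)
    simp [majorant]
  set U := novikovCoef f with hU
  set b := majorant M (13312 * M ^ 2 / d) with hb
  have c0 : ∀ k, ContDiff ℝ (⊤ : ℕ∞) (U k) := contDiff_novikovCoef hf
  have c1 : ∀ k, ContDiff ℝ (⊤ : ℕ∞) (deriv (U k)) := fun k => (c0 k).infty_deriv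
  have c2 : ∀ k, ContDiff ℝ (⊤ : ℕ∞) (deriv (deriv (U k))) := fun k => (c1 k).infty_deriv
  have b0 : ∀ k ≤ n, analyticNorm₁ s (U k) ≤ b k := fun k hk =>
    ih k (Nat.lt_succ_of_le hk) s d hd hsd
  have b1 : ∀ k ≤ n, analyticNorm₁ s (deriv (U k)) ≤ (6 * (n + 1) / d * b k : ℝ≥0) :=
    fun k hk => (analyticNorm₁_deriv_le_of_majorant (ih k (Nat.lt_succ_of_le hk)) hd hsd).trans
      (ENNReal.coe_le_coe.2 (by gcongr))
  have a0 : ∀ k ≤ n, analyticNorm s (U k) ≤ b k := fun k hk =>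
    (analyticNorm_le_one s _).trans (b0 k hk)
  have a1 : ∀ k ≤ n, analyticNorm s (deriv (U k)) ≤ b k := fun k hk =>
    (analyticNorm_deriv_le_one s _).trans (b0 k hk)
  have a1' : ∀ k ≤ n, analyticNorm s (deriv (U k)) ≤ (1 * b k : ℝ≥0) := by simpa using a1
  have a2 : ∀ k ≤ n, analyticNorm s (deriv (deriv (U k))) ≤ (6 * (n + 1) / d * b k : ℝ≥0) :=
    fun k hk => (analyticNorm_deriv_le_one s _).trans (b1 k hk)
  set B := cauchyProd₃ b b b n with hB
  have hsum : ∀ (t : Finset (ℕ × ℕ)) (f : ℕ × ℕ → ℝ → ℝ), (∀ i, ContDiff ℝ (⊤ : ℕ∞) (f i)) →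
      analyticNorm s (∑ i ∈ t, f i) ≤ ∑ i ∈ t, analyticNorm s (f i) :=
    fun t f hf => analyticNorm_sum_le t hf s
  have hmul : ∀ f g : ℝ → ℝ, ContDiff ℝ (⊤ : ℕ∞) f → ContDiff ℝ (⊤ : ℕ∞) g →
      analyticNorm s (f * g) ≤ analyticNorm s f * analyticNorm s g :=
    fun f g hf hg => analyticNorm_mul_le hf hg s
  have t1 : analyticNorm₁ s (cauchyProd₃ U U (fun k => deriv (U k)) n) ≤
      (6 * (n + 1) / d * B : ℝ≥0) :=
    norm_cauchyProd₃_le (N := analyticNorm₁ s) (fun t f hf => analyticNorm₁_sum_le t hf s)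
      (fun f g hf hg => analyticNorm₁_mul_le hf hg s) c0 c0 c1 b0 b0 b1
  have t2 : analyticNorm s (cauchyProd₃ U U (fun k => deriv (U k)) n) ≤ (1 * B : ℝ≥0) :=
    norm_cauchyProd₃_le hsum hmul c0 c0 c1 a0 a0 a1'
  have t3 : analyticNorm s (cauchyProd₃ (fun k => deriv (U k)) (fun k => deriv (U k))
      (fun k => deriv (U k)) n) ≤ (1 * B : ℝ≥0) :=
    norm_cauchyProd₃_le hsum hmul c1 c1 c1 a1 a1 a1'
  have t4 : analyticNorm s (cauchyProd₃ U (fun k => deriv (U k))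
      (fun k => deriv (deriv (U k))) n) ≤ (6 * (n + 1) / d * B : ℝ≥0) :=
    norm_cauchyProd₃_le hsum hmul c0 c1 c2 a0 a1 a2
  have d1 := contDiff_cauchyProd₃ (n := n) (fun k _ => c0 k) (fun k _ => c0 k) (fun k _ => c1 k)
  have d2 := contDiff_cauchyProd₃ (n := n) (fun k _ => c1 k) (fun k _ => c1 k) (fun k _ => c1 k)
  have d3 := contDiff_cauchyProd₃ (n := n) (fun k _ => c0 k) (fun k _ => c1 k) (fun k _ => c2 k)
  have e3 : ‖(3 : ℝ)‖ₑ = ((3 : ℝ≥0) : ℝ≥0∞) := by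
    rw [Real.enorm_of_nonneg (by norm_num)]; simp
  have e2 : ‖(2 : ℝ)‖ₑ = ((2 : ℝ≥0) : ℝ≥0∞) := by
    rw [Real.enorm_of_nonneg (by norm_num)]; simp
  have tS : analyticNorm s (sourceCoef U n) ≤
      (3 * (1 * B) + 2 * (1 * B) + 3 * (6 * (n + 1) / d * B) : ℝ≥0) := by
    rw [sourceCoef]
    refine (analyticNorm_add_le ((d1.infty_const_smul (3 : ℝ)).add (d2.infty_const_smul (2 : ℝ)))
      (d3.infty_const_smul (3 : ℝ)) s).trans ?_
    rw [ENNReal.coe_add, ENNReal.coe_add]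
    refine add_le_add ((analyticNorm_add_le (d1.infty_const_smul (3 : ℝ)) (d2.infty_const_smul (2 : ℝ))
      s).trans (add_le_add ?_ ?_)) ?_
    · rw [analyticNorm_const_smul, ENNReal.coe_mul, e3]; gcongr
    · rw [analyticNorm_const_smul, ENNReal.coe_mul, e2]; gcongr
    · rw [analyticNorm_const_smul, ENNReal.coe_mul, e3]; gcongr
  have cS : ContDiff ℝ (⊤ : ℕ∞) (sourceCoef U n) := contDiff_sourceCoef fun k _ => c0 k
  have pS : Function.Periodic (sourceCoef U n) 1 :=
    periodic_sourceCoef fun k _ => periodic_novikovCoef hp k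
  have en : ‖-((n : ℝ) + 1)⁻¹‖ₑ = (((n : ℝ≥0) + 1)⁻¹ : ℝ≥0) := by
    rw [enorm_neg, enorm_eq_nnnorm]
    congr 1
    ext
    push_cast
    rw [Real.norm_of_nonneg (by positivity)]
  rw [hU, novikovCoef_succ, ← hU, novikovStep, analyticNorm₁_const_smul, en]
  calc _ ≤ (((n : ℝ≥0) + 1)⁻¹ : ℝ≥0) * (((6 * (n + 1) / d * B : ℝ≥0) : ℝ≥0∞) +
        2 * (3 * (1 * B) + 2 * (1 * B) + 3 * (6 * (n + 1) / d * B) : ℝ≥0)) := by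
        gcongr
        refine (analyticNorm₁_add_le d1 (contDiff_infty_greenOp cS) s).trans
          (add_le_add t1 ((analyticNorm₁_greenOp_le cS pS s).trans ?_))
        gcongr
    _ = (((n : ℝ≥0) + 1)⁻¹ * (6 * (n + 1) / d * B +
        2 * (3 * (1 * B) + 2 * (1 * B) + 3 * (6 * (n + 1) / d * B))) : ℝ≥0) := by
        push_cast; ring
    _ ≤ b (n + 1) := by
        refine ENNReal.coe_le_coe.2 ?_
        have hd1 : d ≤ 1 := (hsd ▸ le_add_self : d ≤ δ).trans hδ
        have hB1 : B ≤ (n + 1) / d * B := by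
          refine le_mul_of_one_le_left zero_le ?_
          rw [le_div_iff₀ hd, one_mul]
          exact hd1.trans le_add_self
        calc ((n : ℝ≥0) + 1)⁻¹ * (6 * (n + 1) / d * B +
              2 * (3 * (1 * B) + 2 * (1 * B) + 3 * (6 * (n + 1) / d * B)))
            = ((n : ℝ≥0) + 1)⁻¹ * (42 * ((n + 1) / d * B) + 10 * B) := by ring
          _ ≤ ((n : ℝ≥0) + 1)⁻¹ * (42 * ((n + 1) / d * B) + 10 * ((n + 1) / d * B)) := by gcongr
          _ = 52 / d * B := by
              field_simp
              ring
          _ ≤ 52 / d * (256 * M ^ 2 * (M * (13312 * M ^ 2 / d) ^ n *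
                (((n + 1 : ℕ) + 1 : ℝ≥0) ^ 2)⁻¹)) := by
              gcongr
              exact cauchyProd₃_majorant_le _ _ _
          _ = b (n + 1) := by
              rw [hb, majorant, pow_succ]
              ring

end Recursion

/-! ### Joint analyticity of double power series -/

section DoubleSeries

open scoped NNReal ENNReal Nat Topology
open Finset.HasAntidiagonal (antidiagonal mem_antidiagonal sigmaAntidiagonalEquivProd)

/-- The formal power series on `ℝ × ℝ` of `∑ c n m yⁿ zᵐ`: the monomial `yⁿ zᵐ` comes from the
multilinear map that reads the first coordinate of its first `n` arguments, and the second
coordinate of the others. -/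
def doubleSeries (c : ℕ → ℕ → ℝ) : FormalMultilinearSeries ℝ (ℝ × ℝ) ℝ := fun d =>
  ∑ p ∈ antidiagonal d, c p.1 p.2 •
    (ContinuousMultilinearMap.mkPiAlgebra ℝ (Fin d) ℝ).compContinuousLinearMap fun i =>
      if i.1 < p.1 then ContinuousLinearMap.fst ℝ ℝ ℝ else ContinuousLinearMap.snd ℝ ℝ ℝ

theorem prod_ite_lt (n m : ℕ) (a b : ℝ) :
    ∏ i : Fin (n + m), (if i.1 < n then a else b) = a ^ n * b ^ m := by
  rw [Fin.prod_univ_add]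
  simp

theorem doubleSeries_apply (c : ℕ → ℕ → ℝ) (d : ℕ) (y : ℝ × ℝ) :
    (doubleSeries c d fun _ => y) =
      ∑ p ∈ antidiagonal d, c p.1 p.2 * (y.1 ^ p.1 * y.2 ^ p.2) := by
  rw [doubleSeries, sum_apply]
  refine Finset.sum_congr rfl fun p hp => ?_
  obtain rfl := mem_antidiagonal.1 hp
  rw [smul_apply, ContinuousMultilinearMap.compContinuousLinearMap_apply,
    ContinuousMultilinearMap.mkPiAlgebra_apply, smul_eq_mul, ← prod_ite_lt]
  congr 1
  refine Finset.prod_congr rfl fun i _ => ?_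
  split_ifs <;> rfl

theorem norm_doubleSeries_le (c : ℕ → ℕ → ℝ) (d : ℕ) :
    ‖doubleSeries c d‖ ≤ ∑ p ∈ antidiagonal d, ‖c p.1 p.2‖ := by
  refine (norm_sum_le _ _).trans (Finset.sum_le_sum fun p _ => ?_)
  rw [norm_smul]
  refine mul_le_of_le_one_right (norm_nonneg _) ?_
  refine (ContinuousMultilinearMap.norm_compContinuousLinearMap_le _ _).trans ?_
  rw [ContinuousMultilinearMap.norm_mkPiAlgebra, one_mul]
  refine Finset.prod_le_one (fun _ _ => norm_nonneg _) fun i _ => ?_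
  split_ifs
  · exact ContinuousLinearMap.norm_fst_le ℝ ℝ ℝ
  · exact ContinuousLinearMap.norm_snd_le ℝ ℝ ℝ

theorem hasFPowerSeriesOnBall_doubleSeries {c : ℕ → ℕ → ℝ} {r : ℝ≥0} (hr : 0 < r)
    (hc : Summable fun p : ℕ × ℕ => ‖c p.1 p.2‖ * (r : ℝ) ^ (p.1 + p.2)) {F : ℝ × ℝ → ℝ}
    {z : ℝ × ℝ} (hF : ∀ y : ℝ × ℝ, |y.1| < r → |y.2| < r →
      HasSum (fun p : ℕ × ℕ => c p.1 p.2 * (y.1 ^ p.1 * y.2 ^ p.2)) (F (z + y))) :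
    HasFPowerSeriesOnBall F (doubleSeries c) z r where
  r_pos := by exact_mod_cast hr
  r_le := by
    refine FormalMultilinearSeries.le_radius_of_summable _ ?_
    have h := (sigmaAntidiagonalEquivProd (A := ℕ)).summable_iff.2 hc
    refine Summable.of_nonneg_of_le (fun _ => by positivity) (fun d => ?_) h.sigma
    refine (mul_le_mul_of_nonneg_right (norm_doubleSeries_le c d) (by positivity)).trans
      (le_of_eq ?_)
    rw [Finset.sum_mul]
    refine Eq.trans ?_ (Finset.tsum_subtype (antidiagonal d)
      fun p : ℕ × ℕ => ‖c p.1 p.2‖ * (r : ℝ) ^ (p.1 + p.2)).symm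
    exact Finset.sum_congr rfl fun p hp => by rw [mem_antidiagonal.1 hp]
  hasSum := by
    intro y hy
    rw [Metric.mem_eball, edist_zero_right, enorm_eq_nnnorm] at hy
    have hy : ‖y‖ < r := by exact_mod_cast hy
    have h := (sigmaAntidiagonalEquivProd (A := ℕ)).hasSum_iff.2
      (hF y ((norm_fst_le y).trans_lt hy) ((norm_snd_le y).trans_lt hy))
    refine h.sigma fun d => ?_
    rw [doubleSeries_apply]
    exact Finset.hasSum (antidiagonal d) fun p : ℕ × ℕ => c p.1 p.2 * (y.1 ^ p.1 * y.2 ^ p.2)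

end DoubleSeries

/-! ### Power series in time with analytic coefficients -/

section TimeSeries

open scoped NNReal ENNReal Nat Topology
open Finset.HasAntidiagonal (antidiagonal mem_antidiagonal)

theorem summable_norm_taylorCoef {f : ℝ → ℝ} {s : ℝ≥0} (hs : analyticNorm s f < ⊤) (x : ℝ) :
    Summable fun m => ‖taylorCoef m f x‖ * (s : ℝ) ^ m := by
  have h : ∑' m, ((‖taylorCoef m f x‖₊ * s ^ m : ℝ≥0) : ℝ≥0∞) ≠ ⊤ := by
    refine ((ENNReal.tsum_le_tsum fun m => ?_).trans_lt hs).ne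
    push_cast
    rw [mul_comm]
    gcongr
    exact enorm_taylorCoef_le m f x
  simpa using ENNReal.tsum_coe_ne_top_iff_summable_coe.1 h

/-- A function of finite analytic norm is the sum of its Taylor series. -/
theorem hasSum_taylorCoef {f : ℝ → ℝ} (hf : ContDiff ℝ (⊤ : ℕ∞) f) {s : ℝ≥0}
    (hs : analyticNorm s f < ⊤) (x : ℝ) {h : ℝ} (hh : |h| < s) :
    HasSum (fun m => taylorCoef m f x * h ^ m) (f (x + h)) := by
  have hs0 : (0 : ℝ) < s := (abs_nonneg h).trans_lt hh
  have hsum : Summable fun m => taylorCoef m f x * h ^ m := by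
    refine Summable.of_norm_bounded (summable_norm_taylorCoef hs x) fun m => ?_
    rw [norm_mul, norm_pow, Real.norm_eq_abs h]
    gcongr
  rcases eq_or_ne h 0 with rfl | h0
  · convert hasSum_single (f := fun m => taylorCoef m f x * (0 : ℝ) ^ m) 0
      (fun m hm => by simp [hm]) using 1
    simp [taylorCoef]
  rw [hsum.hasSum_iff_tendsto_nat, ← Filter.tendsto_add_atTop_iff_nat 1,
    tendsto_iff_norm_sub_tendsto_zero]
  -- the remainder of order `n` is at most a constant times `(|h| / s) ^ (n + 1)`
  have hbound : ∀ n y, ‖taylorCoef n f y‖ * (s : ℝ) ^ n ≤ (analyticNorm s f).toReal := by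
    intro n y
    have h1 : ((‖taylorCoef n f y‖₊ * s ^ n : ℝ≥0) : ℝ≥0∞) ≤ analyticNorm s f := by
      refine le_trans ?_ (ENNReal.le_tsum n)
      push_cast
      rw [mul_comm]
      gcongr
      exact enorm_taylorCoef_le n f y
    have h2 := ENNReal.toReal_mono hs.ne h1
    simpa using h2
  have hlim : Filter.Tendsto (fun n : ℕ => (analyticNorm s f).toReal * (|h| / s) ^ (n + 1))
      Filter.atTop (𝓝 0) := by
    have := (tendsto_pow_atTop_nhds_zero_of_lt_one (by positivity)
      ((div_lt_one hs0).2 hh)).const_mul (analyticNorm s f).toReal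
    rw [mul_zero] at this
    exact (Filter.tendsto_add_atTop_iff_nat 1).2 this
  refine squeeze_zero (fun _ => norm_nonneg _) (fun n => ?_) hlim
  have hne : x ≠ x + h := by simpa using h0
  obtain ⟨y, -, hy⟩ := taylor_mean_remainder_lagrange_iteratedDeriv (n := n) hne
    ((hf.of_le (by exact_mod_cast le_top)).contDiffOn : ContDiffOn ℝ (n + 1) f (uIcc x (x + h)))
  have hT : taylorWithinEval f n (uIcc x (x + h)) x (x + h) =
      ∑ m ∈ Finset.range (n + 1), taylorCoef m f x * h ^ m := by
    rw [taylor_within_apply]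
    refine Finset.sum_congr rfl fun m _ => ?_
    rw [iteratedDerivWithin_eq_iteratedDeriv (uniqueDiffOn_uIcc hne)
      (hf.contDiffAt.of_le (by exact_mod_cast le_top)) left_mem_uIcc, taylorCoef, smul_eq_mul,
      add_sub_cancel_left]
    ring
  rw [hT, add_sub_cancel_left] at hy
  rw [norm_sub_rev, hy, mul_div_right_comm]
  change ‖taylorCoef (n + 1) f y * h ^ (n + 1)‖ ≤ _
  rw [norm_mul, norm_pow, Real.norm_eq_abs h, div_pow, mul_div_assoc', le_div_iff₀ (by positivity)]
  calc _ = ‖taylorCoef (n + 1) f y‖ * s ^ (n + 1) * |h| ^ (n + 1) := by ring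
    _ ≤ _ := by gcongr; exact hbound _ _

/-- The function `∑ₙ tⁿ Vₙ(x)`. -/
def timeSeries (V : ℕ → ℝ → ℝ) (t x : ℝ) : ℝ := ∑' n, t ^ n * V n x

theorem analyticOnNhd_timeSeries {U : ℕ → ℝ → ℝ} (hU : ∀ n, ContDiff ℝ (⊤ : ℕ∞) (U n))
    {s M K ε : ℝ≥0} (hb : ∀ n, analyticNorm s (U n) ≤ (M * K ^ n : ℝ≥0)) (hε : 0 < ε)
    (hεs : ε ≤ s) (hεK : ε * K ≤ 1 / 2) :
    AnalyticOnNhd ℝ (fun p : ℝ × ℝ => timeSeries U p.1 p.2) (Ioo (-(ε : ℝ)) ε ×ˢ univ) := by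
  have hfin : ∀ n, analyticNorm s (U n) < ⊤ := fun n => (hb n).trans_lt ENNReal.coe_lt_top
  rintro ⟨t, x⟩ ⟨ht, -⟩
  have hsum : Summable fun p : ℕ × ℕ =>
      ‖taylorCoef p.2 (U p.1) x‖ * (ε : ℝ) ^ (p.1 + p.2) := by
    have h : ∑' p : ℕ × ℕ, ((‖taylorCoef p.2 (U p.1) x‖₊ * ε ^ (p.1 + p.2) : ℝ≥0) : ℝ≥0∞) ≠ ⊤ := by
      rw [ENNReal.tsum_prod']
      have htop : ∑' n : ℕ, (M : ℝ≥0∞) * 2⁻¹ ^ n < ⊤ := by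
        rw [ENNReal.tsum_mul_left, ENNReal.tsum_geometric_two]
        exact ENNReal.mul_lt_top ENNReal.coe_lt_top (by simp)
      refine ((ENNReal.tsum_le_tsum fun n => ?_).trans_lt htop).ne
      calc ∑' m, ((‖taylorCoef m (U n) x‖₊ * ε ^ (n + m) : ℝ≥0) : ℝ≥0∞)
          ≤ ∑' m, (ε : ℝ≥0∞) ^ n * ((s : ℝ≥0∞) ^ m * supTaylor m (U n)) := by
            refine ENNReal.tsum_le_tsum fun m => ?_
            calc ((‖taylorCoef m (U n) x‖₊ * ε ^ (n + m) : ℝ≥0) : ℝ≥0∞)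
                = (ε : ℝ≥0∞) ^ n * ((ε : ℝ≥0∞) ^ m * ‖taylorCoef m (U n) x‖ₑ) := by
                  push_cast
                  rw [enorm_eq_nnnorm, pow_add]
                  ring
              _ ≤ _ := by
                  gcongr
                  exact enorm_taylorCoef_le m (U n) x
        _ = (ε : ℝ≥0∞) ^ n * analyticNorm s (U n) := by rw [ENNReal.tsum_mul_left]; rfl
        _ ≤ (ε : ℝ≥0∞) ^ n * (M * K ^ n : ℝ≥0) := by gcongr; exact hb n
        _ ≤ M * 2⁻¹ ^ n := by
            have : ε ^ n * (M * K ^ n) ≤ M * 2⁻¹ ^ n := by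
              calc ε ^ n * (M * K ^ n) = M * (ε * K) ^ n := by rw [mul_pow]; ring
                _ ≤ _ := by gcongr; rwa [← one_div]
            have h2 : (2⁻¹ : ℝ≥0∞) = ((2⁻¹ : ℝ≥0) : ℝ≥0∞) := by simp
            rw [h2]
            exact_mod_cast this
    simpa using ENNReal.tsum_coe_ne_top_iff_summable_coe.1 h
  have key := hasFPowerSeriesOnBall_doubleSeries (c := fun n m => taylorCoef m (U n) x) hε hsum
    (F := fun p : ℝ × ℝ => timeSeries U p.1 p.2) (z := (0, x)) (fun y hy1 hy2 => ?_)
  · refine key.analyticAt_of_mem ?_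
    rw [Metric.mem_eball, Prod.edist_eq, edist_self, edist_zero_right, max_eq_left zero_le,
      enorm_eq_nnnorm]
    have : |t| < ε := abs_lt.2 ht
    exact_mod_cast this
  · have hs : Summable fun p : ℕ × ℕ => taylorCoef p.2 (U p.1) x * (y.1 ^ p.1 * y.2 ^ p.2) := by
      refine Summable.of_norm_bounded hsum fun p => ?_
      rw [norm_mul, norm_mul, norm_pow, norm_pow, Real.norm_eq_abs y.1, Real.norm_eq_abs y.2,
        pow_add]
      gcongr
    have hrow : ∀ n, HasSum (fun m => taylorCoef m (U n) x * (y.1 ^ n * y.2 ^ m))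
        (y.1 ^ n * U n (x + y.2)) := fun n => by
      have h := (hasSum_taylorCoef (hU n) (hfin n) x
        (hy2.trans_le (by exact_mod_cast hεs))).mul_left (y.1 ^ n)
      simpa only [mul_left_comm (y.1 ^ n)] using h
    convert hs.hasSum using 1
    rw [hs.tsum_prod' fun n => (hrow n).summable]
    simp only [timeSeries, Prod.fst_add, Prod.snd_add, zero_add]
    exact tsum_congr fun n => (hrow n).tsum_eq.symm

end TimeSeries

/-! ### Existence -/

section Existence

open scoped NNReal ENNReal Nat Topology
open Finset.HasAntidiagonal (antidiagonal mem_antidiagonal)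

/-- The coefficients in time grow at most geometrically, in the norm of a fixed strip. -/
theorem exists_novikovCoef_bound {f : ℝ → ℝ} (hf : AnalyticOnNhd ℝ f univ)
    (hp : Function.Periodic f 1) :
    ∃ s M K : ℝ≥0, 0 < s ∧ 1 ≤ K ∧ ∀ n, analyticNorm₁ s (novikovCoef f n) ≤ (M * K ^ n : ℝ≥0) := by
  obtain ⟨r, hr, hfr⟩ := exists_analyticNorm_lt_top hf hp
  set δ : ℝ≥0 := min (r / 2) 1 with hδ
  have hδ0 : 0 < δ := lt_min (half_pos hr) one_pos
  have h1 : analyticNorm₁ δ f < ⊤ := by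
    refine (analyticNorm₁_mono (min_le_left _ _) f).trans_lt ?_
    rw [analyticNorm₁]
    refine ENNReal.add_lt_top.2 ⟨(analyticNorm_mono (half_le_self zero_le) f).trans_lt hfr, ?_⟩
    have h := mul_analyticNorm_deriv_le (r / 2) (r / 2) f
    rw [add_halves] at h
    have h2 := h.trans_lt hfr
    have h0 : ((r / 2 : ℝ≥0) : ℝ≥0∞) ≠ 0 := by exact_mod_cast (half_pos hr).ne'
    exact (ENNReal.mul_lt_top_iff.1 h2).elim And.right fun h => h.elim (fun h => (h0 h).elim)
      fun h => h ▸ ENNReal.zero_lt_top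
  obtain ⟨M, hM⟩ := ENNReal.lt_iff_exists_coe.1 h1
  refine ⟨δ / 2, M, max 1 (13312 * M ^ 2 / (δ / 2)), half_pos hδ0, le_max_left _ _, fun n => ?_⟩
  refine (analyticNorm₁_novikovCoef_le (hf.contDiff) hp (min_le_right _ _) hM.1.le n (δ / 2)
    (δ / 2) (half_pos hδ0) (add_halves δ)).trans (ENNReal.coe_le_coe.2 ?_)
  rw [majorant]
  refine (mul_le_of_le_one_right zero_le ?_).trans ?_
  · exact inv_le_one_of_one_le₀ (one_le_pow₀ le_add_self)
  · gcongr
    exact le_max_right _ _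

theorem abs_le_of_analyticNorm_le {f : ℝ → ℝ} {s B : ℝ≥0} (h : analyticNorm s f ≤ B) (x : ℝ) :
    |f x| ≤ B := by
  have h1 : ‖taylorCoef 0 f x‖ₑ ≤ B := by
    refine ((enorm_taylorCoef_le 0 f x).trans ?_).trans h
    rw [analyticNorm]
    simpa using ENNReal.le_tsum (f := fun m => (s : ℝ≥0∞) ^ m * supTaylor m f) 0
  rw [enorm_eq_nnnorm] at h1
  simpa [taylorCoef] using (show (‖taylorCoef 0 f x‖ : ℝ) ≤ B by exact_mod_cast h1)

theorem abs_deriv_le_of_analyticNorm_le {f : ℝ → ℝ} {s B : ℝ≥0} (hs : 0 < s)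
    (h : analyticNorm s f ≤ B) (x : ℝ) : |deriv f x| ≤ B / s := by
  have h1 : (s : ℝ≥0∞) * ‖taylorCoef 1 f x‖ₑ ≤ B := by
    refine le_trans ?_ ((ENNReal.le_tsum (f := fun m => (s : ℝ≥0∞) ^ m * supTaylor m f) 1).trans h)
    rw [pow_one]
    gcongr
    exact enorm_taylorCoef_le 1 f x
  rw [enorm_eq_nnnorm] at h1
  rw [le_div_iff₀ (by exact_mod_cast hs), mul_comm]
  have h2 : (s : ℝ) * ‖taylorCoef 1 f x‖ ≤ B := by exact_mod_cast h1
  simpa [taylorCoef] using h2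

/-- Derivative in `x` of a series in time. -/
theorem hasDerivAt_timeSeries {V : ℕ → ℝ → ℝ} {V' : ℕ → ℝ → ℝ} {t : ℝ} {u : ℕ → ℝ}
    (hu : Summable u) (hV : ∀ n x, HasDerivAt (V n) (V' n x) x)
    (hb : ∀ n x, |t ^ n * V n x| ≤ u n) (hb' : ∀ n x, |t ^ n * V' n x| ≤ u n) (x : ℝ) :
    HasDerivAt (timeSeries V t) (timeSeries V' t x) x :=
  hasDerivAt_tsum hu (fun n y => (hV n y).const_mul _) hb'
    (.of_norm_bounded hu fun n => hb n 0) x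

theorem continuous_timeSeries {V : ℕ → ℝ → ℝ} {t : ℝ} {u : ℕ → ℝ} (hu : Summable u)
    (hV : ∀ n, Continuous (V n)) (hb : ∀ n x, |t ^ n * V n x| ≤ u n) :
    Continuous (timeSeries V t) :=
  continuous_tsum (fun n => (hV n).const_mul _) hu hb

theorem periodic_timeSeries {V : ℕ → ℝ → ℝ} {c : ℝ} (hV : ∀ n, Function.Periodic (V n) c) (t : ℝ) :
    Function.Periodic (timeSeries V t) c := fun x =>
  tsum_congr fun n => by rw [hV n x]

/-- Derivative in `t` of a series in time. -/
theorem hasDerivAt_timeSeries_time {V : ℕ → ℝ → ℝ} {x B K ε t : ℝ} (hK : 0 < K)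
    (hV : ∀ n, |V n x| ≤ B * K ^ n) (hε : ε * K ≤ 1 / 2) (ht : t ∈ Ioo (-ε) ε) :
    HasDerivAt (fun τ => timeSeries V τ x) (∑' n, t ^ n * ((n + 1) * V (n + 1) x)) t := by
  have hε0 : 0 < ε := by linarith [ht.1, ht.2]
  have hB : 0 ≤ B := by simpa using (abs_nonneg _).trans (hV 0)
  have hsum : Summable fun n : ℕ => B * K * (n * (1 / 2 : ℝ) ^ (n - 1)) := by
    refine Summable.mul_left _ ?_
    rw [← summable_nat_add_iff 1]
    have h1 : Summable fun n : ℕ => (n : ℝ) ^ 1 * (1 / 2 : ℝ) ^ n :=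
      summable_pow_mul_geometric_of_norm_lt_one 1 (by norm_num)
    refine (h1.add summable_geometric_two).congr fun n => ?_
    simp only [Nat.add_sub_cancel]
    push_cast
    ring
  have hbd : ∀ (n : ℕ) (τ : ℝ), τ ∈ Ioo (-ε) ε →
      ‖(n * τ ^ (n - 1)) * V n x‖ ≤ B * K * (n * (1 / 2 : ℝ) ^ (n - 1)) := by
    intro n τ hτ
    have hτ' : |τ| ≤ ε := (abs_lt.2 hτ).le
    rcases n with _ | n
    · simp
    rw [norm_mul, norm_mul, norm_pow, Real.norm_eq_abs τ, Real.norm_natCast, Nat.add_sub_cancel,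
      Real.norm_eq_abs]
    calc ((n + 1 : ℕ) : ℝ) * |τ| ^ n * |V (n + 1) x|
        ≤ ((n + 1 : ℕ) : ℝ) * ε ^ n * (B * K ^ (n + 1)) := by
          gcongr
          exact hV _
      _ = B * K * ((n + 1 : ℕ) * (ε * K) ^ n) := by rw [mul_pow]; ring
      _ ≤ _ := by gcongr
  have h := hasDerivAt_tsum_of_isPreconnected (g := fun n (τ : ℝ) => τ ^ n * V n x)
    (g' := fun n τ => (n * τ ^ (n - 1)) * V n x) hsum isOpen_Ioo isPreconnected_Ioo
    (fun n τ _ => (hasDerivAt_pow n τ).mul_const _) hbd (y₀ := 0) ⟨by linarith, hε0⟩ ?_ ht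
  · refine h.congr_deriv ?_
    have hs : Summable fun n : ℕ => (n * t ^ (n - 1)) * V n x :=
      .of_norm_bounded hsum fun n => hbd n t ht
    refine hs.tsum_eq_zero_add.trans ?_
    rw [Nat.cast_zero, zero_mul, zero_mul, zero_add]
    refine tsum_congr fun n => ?_
    rw [Nat.add_sub_cancel]
    push_cast
    ring
  · refine summable_of_ne_finset_zero (s := {0}) fun n hn => ?_
    have : n ≠ 0 := by simpa using hn
    simp [this]

theorem summable_norm_cauchyProd₃ {a b c : ℕ → ℝ} (ha : Summable fun n => ‖a n‖)
    (hb : Summable fun n => ‖b n‖) (hc : Summable fun n => ‖c n‖) :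
    Summable fun n => ‖cauchyProd₃ a b c n‖ := by
  simp only [cauchyProd₃_eq]
  exact summable_norm_sum_mul_antidiagonal_of_summable_norm (f := a)
    (g := fun n => ∑ q ∈ antidiagonal n, b q.1 * c q.2) ha
    (summable_norm_sum_mul_antidiagonal_of_summable_norm hb hc)

theorem tsum_cauchyProd₃ {a b c : ℕ → ℝ} (ha : Summable fun n => ‖a n‖)
    (hb : Summable fun n => ‖b n‖) (hc : Summable fun n => ‖c n‖) :
    ∑' n, cauchyProd₃ a b c n = (∑' n, a n) * ((∑' n, b n) * ∑' n, c n) := by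
  simp only [cauchyProd₃_eq]
  rw [tsum_mul_tsum_eq_tsum_sum_antidiagonal_of_summable_norm hb hc,
    tsum_mul_tsum_eq_tsum_sum_antidiagonal_of_summable_norm (f := a)
      (g := fun n => ∑ q ∈ antidiagonal n, b q.1 * c q.2) ha
      (summable_norm_sum_mul_antidiagonal_of_summable_norm hb hc)]

theorem cauchyProd₃_apply (f g h : ℕ → ℝ → ℝ) (n : ℕ) (x : ℝ) :
    cauchyProd₃ f g h n x = cauchyProd₃ (fun k => f k x) (fun k => g k x) (fun k => h k x) n := by
  simp [cauchyProd₃]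

theorem pow_mul_cauchyProd₃ (t : ℝ) (a b c : ℕ → ℝ) (n : ℕ) :
    t ^ n * cauchyProd₃ a b c n =
      cauchyProd₃ (fun k => t ^ k * a k) (fun k => t ^ k * b k) (fun k => t ^ k * c k) n := by
  simp only [cauchyProd₃, Finset.mul_sum]
  refine Finset.sum_congr rfl fun p hp => Finset.sum_congr rfl fun q hq => ?_
  rw [← mem_antidiagonal.1 hp, pow_add, ← mem_antidiagonal.1 hq, pow_add]
  ring

theorem abs_cauchyProd₃_le {a b c A B C : ℕ → ℝ} (ha : ∀ n, |a n| ≤ A n) (hb : ∀ n, |b n| ≤ B n)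
    (hc : ∀ n, |c n| ≤ C n) (n : ℕ) : |cauchyProd₃ a b c n| ≤ cauchyProd₃ A B C n := by
  refine (Finset.abs_sum_le_sum_abs _ _).trans (Finset.sum_le_sum fun p _ => ?_)
  refine (Finset.abs_sum_le_sum_abs _ _).trans (Finset.sum_le_sum fun q _ => ?_)
  rw [abs_mul, abs_mul]
  have hA := (abs_nonneg _).trans (ha p.1)
  have hB := (abs_nonneg _).trans (hb q.1)
  have hC := (abs_nonneg _).trans (hc q.2)
  gcongr
  exacts [ha _, hb _, hc _]

theorem timeSeries_cauchyProd₃ {f g h : ℕ → ℝ → ℝ} {t x : ℝ}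
    (hf : Summable fun n => ‖t ^ n * f n x‖) (hg : Summable fun n => ‖t ^ n * g n x‖)
    (hh : Summable fun n => ‖t ^ n * h n x‖) :
    (Summable fun n => t ^ n * cauchyProd₃ f g h n x) ∧
      timeSeries (cauchyProd₃ f g h) t x =
        timeSeries f t x * (timeSeries g t x * timeSeries h t x) := by
  have e : ∀ n, t ^ n * cauchyProd₃ f g h n x = cauchyProd₃ (fun k => t ^ k * f k x)
      (fun k => t ^ k * g k x) (fun k => t ^ k * h k x) n := fun n => by
    rw [cauchyProd₃_apply, pow_mul_cauchyProd₃]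
  simp only [timeSeries, e]
  exact ⟨(summable_norm_cauchyProd₃ hf hg hh).of_norm, tsum_cauchyProd₃ hf hg hh⟩

theorem circleDeriv_coe (f : UnitAddCircle → ℝ) (x : ℝ) :
    circleDeriv f x = deriv (fun y : ℝ => f y) x := by
  have h := deriv_comp_const_add (fun y : ℝ => f y) x 0
  rw [add_zero] at h
  rw [circleDeriv, ← h]
  simp only [AddCircle.coe_add]

/-- The power series in time built on the recursion solves the Novikov equation. -/
theorem novikov_timeSeries {f : ℝ → ℝ} (hf : ContDiff ℝ (⊤ : ℕ∞) f) (hp : Function.Periodic f 1)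
    {B K ε t : ℝ} (hK : 0 < K) (hεK : ε * K ≤ 1 / 2) (ht : t ∈ Ioo (-ε) ε)
    (b0 : ∀ n x, |novikovCoef f n x| ≤ B * K ^ n)
    (b1 : ∀ n x, |deriv (novikovCoef f n) x| ≤ B * K ^ n)
    (b2 : ∀ n x, |deriv (deriv (novikovCoef f n)) x| ≤ B * K ^ n)
    {u : ℝ → UnitAddCircle → ℝ} (hu : ∀ τ (x : ℝ), u τ x = timeSeries (novikovCoef f) τ x)
    (x : UnitAddCircle) :
    deriv (fun τ : ℝ => u τ x) t + u t x ^ 2 * circleDeriv (u t) x =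
      -invLambdaSq (novikovSource (u t)) x := by
  set U := novikovCoef f with hU
  set U' := fun n => deriv (U n) with hU'
  set U'' := fun n => deriv (U' n) with hU''
  have c0 : ∀ n, ContDiff ℝ (⊤ : ℕ∞) (U n) := contDiff_novikovCoef hf
  have c1 : ∀ n, ContDiff ℝ (⊤ : ℕ∞) (U' n) := fun n => (c0 n).infty_deriv
  have c2 : ∀ n, ContDiff ℝ (⊤ : ℕ∞) (U'' n) := fun n => (c1 n).infty_deriv
  have cS : ∀ n, ContDiff ℝ (⊤ : ℕ∞) (sourceCoef U n) := fun n => contDiff_sourceCoef fun k _ => c0 k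
  have pS : ∀ n, Function.Periodic (sourceCoef U n) 1 := fun n =>
    periodic_sourceCoef fun k _ => periodic_novikovCoef hp k
  have one : ∀ {g : ℝ → ℝ}, ContDiff ℝ (⊤ : ℕ∞) g → ContDiff ℝ 1 g := fun hg =>
    hg.of_le (by exact_mod_cast le_top)
  have hB : 0 ≤ B := by simpa using (abs_nonneg _).trans (b0 0 0)
  have htK : |t| * K ≤ 1 / 2 := by
    refine le_trans ?_ hεK
    gcongr
    exact (abs_lt.2 ht).le
  -- majorants of the coefficients of `u`, `uₓ`, `uₓₓ` and of the source
  set β : ℕ → ℝ := fun n => |t| ^ n * (B * K ^ n) with hβ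
  have β0 : ∀ n, 0 ≤ β n := fun n => by positivity
  have βs : Summable β := by
    refine Summable.of_nonneg_of_le β0 (fun n => ?_)
      ((summable_geometric_two).mul_left B)
    calc β n = B * (|t| * K) ^ n := by rw [hβ, mul_pow]; ring
      _ ≤ B * (1 / 2) ^ n := by gcongr
  have βn : Summable fun n => ‖β n‖ := by
    simpa only [Real.norm_of_nonneg (β0 _)] using βs
  have bd : ∀ {V : ℕ → ℝ → ℝ}, (∀ n x, |V n x| ≤ B * K ^ n) → ∀ n x, |t ^ n * V n x| ≤ β n := by
    intro V hV n x
    rw [abs_mul, abs_pow]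
    exact mul_le_mul_of_nonneg_left (hV n x) (by positivity)
  have sm : ∀ {V : ℕ → ℝ → ℝ}, (∀ n x, |V n x| ≤ B * K ^ n) → ∀ x,
      Summable fun n => ‖t ^ n * V n x‖ := fun hV x =>
    Summable.of_nonneg_of_le (fun _ => norm_nonneg _) (fun n => bd hV n x) βs
  set σ : ℕ → ℝ := fun n => 8 * cauchyProd₃ (fun n => B * K ^ n) (fun n => B * K ^ n)
    (fun n => B * K ^ n) n with hσ
  have bS : ∀ n x, |sourceCoef U n x| ≤ σ n := by
    intro n x
    simp only [sourceCoef, Pi.add_apply, Pi.smul_apply, smul_eq_mul, cauchyProd₃_apply, hσ]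
    have h1 := abs_cauchyProd₃_le (fun n => b0 n x) (fun n => b0 n x) (fun n => b1 n x) n
    have h2 := abs_cauchyProd₃_le (fun n => b1 n x) (fun n => b1 n x) (fun n => b1 n x) n
    have h3 := abs_cauchyProd₃_le (fun n => b0 n x) (fun n => b1 n x) (fun n => b2 n x) n
    rw [abs_le] at h1 h2 h3 ⊢
    constructor <;> linarith [h1.1, h1.2, h2.1, h2.2, h3.1, h3.2]
  set ω : ℕ → ℝ := fun n => |t| ^ n * (2 * σ n) with hω
  have ωs : Summable ω := by
    have h := ((summable_norm_cauchyProd₃ βn βn βn).of_norm).mul_left 16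
    refine h.congr fun n => ?_
    rw [hω, hβ, ← pow_mul_cauchyProd₃, hσ]
    ring
  have bdS : ∀ {V : ℕ → ℝ → ℝ}, (∀ n x, |V n x| ≤ 2 * σ n) → ∀ n x, |t ^ n * V n x| ≤ ω n := by
    intro V hV n x
    rw [abs_mul, abs_pow]
    exact mul_le_mul_of_nonneg_left (hV n x) (by positivity)
  have σ0 : ∀ n, 0 ≤ σ n := fun n => (abs_nonneg _).trans (bS n 0)
  -- space derivatives of `u`
  have e1 : ∀ x, HasDerivAt (timeSeries U t) (timeSeries U' t x) x :=
    hasDerivAt_timeSeries βs (fun n x => ((one (c0 n)).differentiable one_ne_zero x).hasDerivAt)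
      (bd b0) (bd b1)
  have e2 : ∀ x, HasDerivAt (timeSeries U' t) (timeSeries U'' t x) x :=
    hasDerivAt_timeSeries βs (fun n x => ((one (c1 n)).differentiable one_ne_zero x).hasDerivAt)
      (bd b1) (bd b2)
  have ux : ∀ x : ℝ, circleDeriv (u t) x = timeSeries U' t x := fun x => by
    rw [circleDeriv_coe, show (fun y : ℝ => u t y) = timeSeries U t from funext (hu t)]
    exact (e1 x).deriv
  have uxx : ∀ x : ℝ, circleDeriv (circleDeriv (u t)) x = timeSeries U'' t x := fun x => by
    rw [circleDeriv_coe, show (fun y : ℝ => circleDeriv (u t) y) = timeSeries U' t from funext ux]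
    exact (e2 x).deriv
  -- the source is the sum of the series of its coefficients
  have src : ∀ x : ℝ, timeSeries (sourceCoef U) t x = novikovSource (u t) x := by
    intro x
    obtain ⟨s1, h1⟩ := timeSeries_cauchyProd₃ (sm b0 x) (sm b0 x) (sm b1 x)
    obtain ⟨s2, h2⟩ := timeSeries_cauchyProd₃ (sm b1 x) (sm b1 x) (sm b1 x)
    obtain ⟨s3, h3⟩ := timeSeries_cauchyProd₃ (sm b0 x) (sm b1 x) (sm b2 x)
    have hs := ((s1.hasSum.mul_left 3).add (s2.hasSum.mul_left 2)).add (s3.hasSum.mul_left 3)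
    rw [novikovSource, hu, ux, uxx, timeSeries]
    refine Eq.trans (tsum_congr fun n => ?_) (hs.tsum_eq.trans ?_)
    · simp only [sourceCoef, Pi.add_apply, Pi.smul_apply, smul_eq_mul]
      ring
    · change 3 * timeSeries (cauchyProd₃ U U U') t x + 2 * timeSeries (cauchyProd₃ U' U' U') t x +
        3 * timeSeries (cauchyProd₃ U U' U'') t x = _
      rw [h1, h2, h3]
      ring
  -- the nonlocal term
  set W := fun n => greenOp (sourceCoef U n) with hW
  have bW : ∀ n x, |W n x| ≤ 2 * σ n := fun n x =>
    (abs_greenOp_le (bS n) x).trans (by linarith [σ0 n])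
  have bW' : ∀ n x, |deriv (W n) x| ≤ 2 * σ n := fun n x =>
    (abs_deriv_greenOp_le (one (cS n)) (pS n) (bS n) x).trans (by linarith [σ0 n])
  have bW'' : ∀ n x, |W n x - sourceCoef U n x| ≤ 2 * σ n := fun n x =>
    (abs_sub _ _).trans (by linarith [abs_greenOp_le (bS n) x, bS n x])
  have bS' : ∀ n x, |sourceCoef U n x| ≤ 2 * σ n := fun n x =>
    (bS n x).trans (by linarith [σ0 n])
  have cW : ∀ n, ContDiff ℝ (⊤ : ℕ∞) (W n) := fun n => contDiff_infty_greenOp (cS n)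
  have pW : ∀ n, Function.Periodic (W n) 1 := fun n => (pS n).greenOp
  have hpW := periodic_timeSeries pW t
  have inv : invLambdaSq (novikovSource (u t)) = hpW.lift := by
    refine invLambdaSq_eq_of_helmholtz (w₁ := timeSeries (fun n => deriv (W n)) t)
      (w₂ := timeSeries (fun n x => W n x - sourceCoef U n x) t) (fun x => ?_) (fun x => ?_) ?_ ?_
      fun x => ?_
    · exact hasDerivAt_timeSeries ωs
        (fun n x => ((one (cW n)).differentiable one_ne_zero x).hasDerivAt) (bdS bW) (bdS bW') x
    · exact hasDerivAt_timeSeries ωs (fun n x => greenOp_sub_deriv_deriv (one (cS n)) (pS n) x)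
        (bdS bW') (bdS bW'') x
    · exact continuous_timeSeries ωs (fun n => (cW n).continuous.sub (cS n).continuous) (bdS bW'')
    · have := periodic_timeSeries (fun n => (pW n).deriv) t 0
      rwa [zero_add] at this
    · have s1 : Summable fun n => t ^ n * W n x := .of_norm_bounded ωs fun n => bdS bW n x
      have s2 : Summable fun n => t ^ n * (W n x - sourceCoef U n x) :=
        .of_norm_bounded ωs fun n => bdS bW'' n x
      rw [Function.Periodic.lift_coe, ← src, timeSeries, timeSeries, timeSeries, ← s1.tsum_sub s2]
      exact tsum_congr fun n => by ring
  induction x using QuotientAddGroup.induction_on with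
  | H x =>
    change deriv (fun τ : ℝ => u τ (x : UnitAddCircle)) t + u t (x : UnitAddCircle) ^ 2 *
      circleDeriv (u t) (x : UnitAddCircle) = -invLambdaSq (novikovSource (u t)) (x : UnitAddCircle)
    obtain ⟨s1, h1⟩ := timeSeries_cauchyProd₃ (sm b0 x) (sm b0 x) (sm b1 x)
    have s2 : Summable fun n => t ^ n * W n x := .of_norm_bounded ωs fun n => bdS bW n x
    have ut := hasDerivAt_timeSeries_time hK (fun n => b0 n x) hεK ht
    rw [inv, Function.Periodic.lift_coe, ux, funext fun τ => hu τ x, ut.deriv, hu]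
    have hstep : ∀ n, t ^ n * ((n + 1) * U (n + 1) x) =
        -(t ^ n * cauchyProd₃ U U U' n x + t ^ n * W n x) := by
      intro n
      rw [hU, novikovCoef_succ, ← hU, novikovStep]
      simp only [Pi.smul_apply, Pi.add_apply, smul_eq_mul]
      have : (n : ℝ) + 1 ≠ 0 := by positivity
      field_simp
      rfl
    rw [tsum_congr hstep, tsum_neg, s1.tsum_add s2]
    change -(timeSeries (cauchyProd₃ U U U') t x + timeSeries W t x) + _ = -timeSeries W t x
    rw [h1]
    ring

theorem exists_isAnalyticNovikovSolution {u₀ : UnitAddCircle → ℝ} (hu₀ : CircleAnalytic u₀) :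
    ∃ ε : ℝ, 0 < ε ∧ ∃ u : ℝ → UnitAddCircle → ℝ, IsAnalyticNovikovSolution u₀ ε u := by
  set f : ℝ → ℝ := fun x => u₀ x with hf
  have hp : Function.Periodic f 1 := fun x => by simp [hf]
  obtain ⟨s, M, K, hs, hK, hb⟩ := exists_novikovCoef_bound hu₀ hp
  have hK0 : 0 < K := one_pos.trans_le hK
  have hcd : ContDiff ℝ (⊤ : ℕ∞) f := AnalyticOnNhd.contDiff hu₀
  set ε : ℝ≥0 := min s (1 / (2 * K)) with hε
  have hε0 : 0 < ε := lt_min hs (by positivity)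
  have hεK : ε * K ≤ 1 / 2 := by
    calc ε * K ≤ 1 / (2 * K) * K := by gcongr; exact min_le_right _ _
      _ = 1 / 2 := by field_simp
  have hN : ∀ n, analyticNorm s (novikovCoef f n) ≤ (M * K ^ n : ℝ≥0) := fun n =>
    (analyticNorm_le_one _ _).trans (hb n)
  have hN' : ∀ n, analyticNorm s (deriv (novikovCoef f n)) ≤ (M * K ^ n : ℝ≥0) := fun n =>
    (analyticNorm_deriv_le_one _ _).trans (hb n)
  set B : ℝ := M + M / s with hB
  have hs' : (0 : ℝ) < s := by exact_mod_cast hs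
  have b0 : ∀ n x, |novikovCoef f n x| ≤ B * (K : ℝ) ^ n := fun n x => by
    refine (abs_le_of_analyticNorm_le (hN n) x).trans ?_
    push_cast
    gcongr
    exact le_add_of_nonneg_right (by positivity)
  have b1 : ∀ n x, |deriv (novikovCoef f n) x| ≤ B * (K : ℝ) ^ n := fun n x => by
    refine (abs_le_of_analyticNorm_le (hN' n) x).trans ?_
    push_cast
    gcongr
    exact le_add_of_nonneg_right (by positivity)
  have b2 : ∀ n x, |deriv (deriv (novikovCoef f n)) x| ≤ B * (K : ℝ) ^ n := fun n x => by
    refine (abs_deriv_le_of_analyticNorm_le hs (hN' n) x).trans ?_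
    push_cast
    rw [mul_div_right_comm]
    gcongr
    exact le_add_of_nonneg_left (by positivity)
  refine ⟨ε, by exact_mod_cast hε0,
    fun t => (periodic_timeSeries (periodic_novikovCoef hp) t).lift, ?_, ?_, ?_⟩
  · simp only [TimeCircleAnalyticOn, Function.Periodic.lift_coe]
    exact analyticOnNhd_timeSeries (contDiff_novikovCoef hcd) hN hε0 (min_le_left _ _) hεK
  · intro t ht x
    exact novikov_timeSeries hcd hp (by exact_mod_cast hK0) (by exact_mod_cast hεK) ht b0 b1 b2
      (u := fun t => (periodic_timeSeries (periodic_novikovCoef hp) t).lift)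
      (fun τ x => Function.Periodic.lift_coe _ _) x
  · intro x
    induction x using QuotientAddGroup.induction_on with
    | H x =>
      refine (Function.Periodic.lift_coe _ x).trans ?_
      rw [timeSeries, tsum_eq_single 0 fun n hn => by simp [hn]]
      simp [novikovCoef_zero, hf]

end Existence

/-! ### Uniqueness -/

section Uniqueness

open scoped NNReal ENNReal Nat Topology

/-- The derivative of a function on space-time in the fixed direction `v`. -/
def dirDeriv (v : ℝ × ℝ) (g : ℝ × ℝ → ℝ) (p : ℝ × ℝ) : ℝ := fderiv ℝ g p v

theorem AnalyticOnNhd.dirDeriv {g : ℝ × ℝ → ℝ} {Ω : Set (ℝ × ℝ)} (hg : AnalyticOnNhd ℝ g Ω)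
    (v : ℝ × ℝ) : AnalyticOnNhd ℝ (dirDeriv v g) Ω :=
  (ContinuousLinearMap.apply ℝ ℝ v).comp_analyticOnNhd hg.fderiv

theorem Function.Periodic.dirDeriv {g : ℝ × ℝ → ℝ} {c : ℝ × ℝ} (hg : Function.Periodic g c)
    (v : ℝ × ℝ) : Function.Periodic (dirDeriv v g) c := fun p => by
  rw [_root_.dirDeriv, _root_.dirDeriv, ← fderiv_comp_add_right,
    show (fun x => g (x + c)) = g from funext hg]

theorem dirDeriv_comm {g : ℝ × ℝ → ℝ} {p : ℝ × ℝ} (hg : AnalyticAt ℝ g p) (v w : ℝ × ℝ) :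
    dirDeriv v (dirDeriv w g) p = dirDeriv w (dirDeriv v g) p := by
  have h : ∀ v w, dirDeriv v (dirDeriv w g) p = fderiv ℝ (fderiv ℝ g) p v w := fun v w => by
    have := ((ContinuousLinearMap.apply ℝ ℝ w).hasFDerivAt.comp p
      hg.fderiv.differentiableAt.hasFDerivAt).fderiv
    rw [dirDeriv, show dirDeriv w g = (ContinuousLinearMap.apply ℝ ℝ w) ∘ fderiv ℝ g from rfl, this]
    rfl
  rw [h, h]
  exact hg.contDiffAt.isSymmSndFDerivAt (n := 2) (by simp) v w

theorem analyticOnNhd_iterate_dirDeriv {g : ℝ × ℝ → ℝ} {Ω : Set (ℝ × ℝ)}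
    (hg : AnalyticOnNhd ℝ g Ω) (v : ℝ × ℝ) (j : ℕ) : AnalyticOnNhd ℝ ((dirDeriv v)^[j] g) Ω := by
  induction j with
  | zero => exact hg
  | succ j ih => rw [Function.iterate_succ_apply']; exact ih.dirDeriv v

theorem iterate_dirDeriv_comm {g : ℝ × ℝ → ℝ} {Ω : Set (ℝ × ℝ)} (hΩ : IsOpen Ω)
    (hg : AnalyticOnNhd ℝ g Ω) (v w : ℝ × ℝ) (j : ℕ) :
    EqOn ((dirDeriv v)^[j] (dirDeriv w g)) (dirDeriv w ((dirDeriv v)^[j] g)) Ω := by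
  induction j with
  | zero => exact fun _ _ => rfl
  | succ j ih =>
    intro p hp
    rw [Function.iterate_succ_apply', Function.iterate_succ_apply',
      ← dirDeriv_comm (analyticOnNhd_iterate_dirDeriv hg v j p hp)]
    exact congrArg (fun L : ℝ × ℝ →L[ℝ] ℝ => L v)
      (Filter.EventuallyEq.fderiv_eq (ih.eventuallyEq_of_mem (hΩ.mem_nhds hp)))

theorem hasDerivAt_time {g : ℝ × ℝ → ℝ} {t x : ℝ} (hg : AnalyticAt ℝ g (t, x)) :
    HasDerivAt (fun τ => g (τ, x)) (dirDeriv (1, 0) g (t, x)) t :=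
  hg.differentiableAt.hasFDerivAt.comp_hasDerivAt t ((hasDerivAt_id t).prodMk (hasDerivAt_const t x))

theorem hasDerivAt_space {g : ℝ × ℝ → ℝ} {t x : ℝ} (hg : AnalyticAt ℝ g (t, x)) :
    HasDerivAt (fun y => g (t, y)) (dirDeriv (0, 1) g (t, x)) x :=
  hg.differentiableAt.hasFDerivAt.comp_hasDerivAt x ((hasDerivAt_const x t).prodMk (hasDerivAt_id x))

/-- The space-time strip `(-ε, ε) × ℝ` over `(-ε, ε) × 𝕋`. -/
def strip (ε : ℝ) : Set (ℝ × ℝ) := Ioo (-ε) ε ×ˢ univ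

theorem isOpen_strip (ε : ℝ) : IsOpen (strip ε) := isOpen_Ioo.prod isOpen_univ

/-- All derivatives in time of order less than `n` vanish at time `0`. -/
def VanishesToOrder (n : ℕ) (g : ℝ × ℝ → ℝ) : Prop :=
  ∀ j < n, ∀ x, (dirDeriv (1, 0))^[j] g (0, x) = 0

theorem VanishesToOrder.dirDeriv_space {n : ℕ} {g : ℝ × ℝ → ℝ} {ε : ℝ} (hε : 0 < ε)
    (hg : AnalyticOnNhd ℝ g (strip ε)) (h : VanishesToOrder n g) :
    VanishesToOrder n (dirDeriv (0, 1) g) := by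
  intro j hj x
  have h0 : ((0 : ℝ), x) ∈ strip ε := ⟨⟨by simpa using hε, hε⟩, mem_univ _⟩
  rw [iterate_dirDeriv_comm (isOpen_strip ε) hg _ _ j h0,
    ← (hasDerivAt_space (analyticOnNhd_iterate_dirDeriv hg (1, 0) j _ h0)).deriv]
  simp only [h j hj, deriv_const]

/-- Vanishing to order `n` at time `0` gives a bound by `|t|ⁿ`, uniformly in space. -/
theorem VanishesToOrder.exists_bound {n : ℕ} {g : ℝ × ℝ → ℝ} {ε t₀ : ℝ} (ht₀ : 0 < t₀)
    (htε : t₀ < ε) (hg : AnalyticOnNhd ℝ g (strip ε)) (hp : Function.Periodic g (0, 1))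
    (h : VanishesToOrder n g) :
    ∃ C : ℝ, 0 ≤ C ∧ ∀ t ∈ Icc (-t₀) t₀, ∀ x, |g (t, x)| ≤ C * |t| ^ n := by
  have hsub : ∀ t ∈ Icc (-t₀) t₀, ∀ x, (t, x) ∈ strip ε := fun t ht x =>
    ⟨⟨by linarith [ht.1], by linarith [ht.2]⟩, mem_univ _⟩
  induction n generalizing g with
  | zero =>
    obtain ⟨C, hC⟩ := (isCompact_Icc.prod isCompact_Icc :
      IsCompact (Icc (-t₀) t₀ ×ˢ Icc (0 : ℝ) 1)).exists_bound_of_continuousOn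
      (hg.continuousOn.mono fun p hp => hsub p.1 hp.1 p.2)
    refine ⟨C, (norm_nonneg _).trans (hC (0, 0) ⟨⟨by simpa using ht₀.le, ht₀.le⟩, by simp⟩),
      fun t ht x => ?_⟩
    have hpt : Function.Periodic (fun y => g (t, y)) 1 := fun y => by
      simpa using hp (t, y)
    obtain ⟨y, hy, hxy⟩ := hpt.exists_mem_Ico₀ one_pos x
    rw [pow_zero, mul_one]
    exact hxy ▸ hC (t, y) ⟨ht, hy.1, hy.2.le⟩
  | succ n ih =>
    obtain ⟨C, hC0, hC⟩ := ih (hg.dirDeriv (1, 0)) (hp.dirDeriv (1, 0)) fun j hj x => by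
      have := h (j + 1) (by omega) x
      rwa [Function.iterate_succ_apply] at this
    refine ⟨C, hC0, fun t ht x => ?_⟩
    have h0 : g (0, x) = 0 := h 0 (by omega) x
    have hseg : ∀ τ ∈ uIcc 0 t, τ ∈ Icc (-t₀) t₀ ∧ |τ| ≤ |t| := by
      intro τ hτ
      have h1 : |τ| ≤ |t| := by
        have := abs_sub_left_of_mem_uIcc hτ
        simpa using this
      exact ⟨abs_le.1 (h1.trans (abs_le.2 ht)), h1⟩
    have hmv := (convex_uIcc (0 : ℝ) t).norm_image_sub_le_of_norm_hasDerivWithin_le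
      (f := fun τ => g (τ, x)) (f' := fun τ => dirDeriv (1, 0) g (τ, x)) (C := C * |t| ^ n)
      (fun τ hτ => (hasDerivAt_time (hg _ (hsub τ (hseg τ hτ).1 x))).hasDerivWithinAt)
      (fun τ hτ => (hC τ (hseg τ hτ).1 x).trans (mul_le_mul_of_nonneg_left
        (pow_le_pow_left₀ (abs_nonneg _) (hseg τ hτ).2 n) hC0))
      left_mem_uIcc right_mem_uIcc
    simpa [h0, pow_succ, mul_assoc] using hmv

theorem natCast_le_analyticOrderAt_of_bound {f : ℝ → ℝ} (hf : AnalyticAt ℝ f 0) {C : ℝ} {n : ℕ}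
    (h : ∀ᶠ t in 𝓝 0, |f t| ≤ C * |t| ^ n) : n ≤ analyticOrderAt f 0 := by
  by_contra hlt
  rw [not_le] at hlt
  obtain ⟨m, hm⟩ := ENat.ne_top_iff_exists.1 (hlt.trans_le le_top).ne
  rw [← hm] at hlt
  have hmn : m < n := by exact_mod_cast hlt
  obtain ⟨g, hg, hg0, hfg⟩ := hf.analyticOrderAt_eq_natCast.1 hm.symm
  refine hg0 (abs_eq_zero.1 (le_antisymm ?_ (abs_nonneg _)))
  have hl : Filter.Tendsto (fun t => |g t|) (𝓝[≠] 0) (𝓝 |g 0|) :=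
    (hg.continuousAt.abs.tendsto).mono_left nhdsWithin_le_nhds
  have hr : Filter.Tendsto (fun t : ℝ => C * |t| ^ (n - m)) (𝓝[≠] 0) (𝓝 0) := by
    have hc : ContinuousAt (fun t : ℝ => C * |t| ^ (n - m)) 0 := by fun_prop
    have h0 : C * |(0 : ℝ)| ^ (n - m) = 0 := by
      rw [abs_zero, zero_pow (by omega), mul_zero]
    simpa only [h0] using hc.tendsto.mono_left (nhdsWithin_le_nhds (s := {0}ᶜ))
  refine le_of_tendsto_of_tendsto hl hr ?_
  filter_upwards [self_mem_nhdsWithin, nhdsWithin_le_nhds h, nhdsWithin_le_nhds hfg] with t ht h1 h2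
  have ht : 0 < |t| := abs_pos.2 ht
  rw [h2, sub_zero, smul_eq_mul, abs_mul, abs_pow, show n = m + (n - m) by omega, pow_add] at h1
  refine le_of_mul_le_mul_left ?_ (pow_pos ht m)
  linarith

theorem iteratedDeriv_time {g : ℝ × ℝ → ℝ} {ε : ℝ} (hg : AnalyticOnNhd ℝ g (strip ε)) (x : ℝ)
    (j : ℕ) {t : ℝ} (ht : t ∈ Ioo (-ε) ε) :
    iteratedDeriv j (fun τ => g (τ, x)) t = (dirDeriv (1, 0))^[j] g (t, x) := by
  induction j generalizing t with
  | zero => simp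
  | succ j ih =>
    rw [iteratedDeriv_succ, Function.iterate_succ_apply',
      ← (hasDerivAt_time (analyticOnNhd_iterate_dirDeriv hg (1, 0) j (t, x) ⟨ht, mem_univ _⟩)).deriv]
    refine Filter.EventuallyEq.deriv_eq ?_
    filter_upwards [isOpen_Ioo.mem_nhds ht] with τ hτ using ih hτ

theorem analyticAt_time {g : ℝ × ℝ → ℝ} {t x : ℝ} (hg : AnalyticAt ℝ g (t, x)) :
    AnalyticAt ℝ (fun τ => g (τ, x)) t :=
  hg.comp₂ analyticAt_id analyticAt_const

theorem analyticAt_space {g : ℝ × ℝ → ℝ} {t x : ℝ} (hg : AnalyticAt ℝ g (t, x)) :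
    AnalyticAt ℝ (fun y => g (t, y)) x :=
  hg.comp₂ analyticAt_const analyticAt_id

theorem vanishesToOrder_of_bound {n : ℕ} {g : ℝ × ℝ → ℝ} {ε t₀ C : ℝ} (ht₀ : 0 < t₀)
    (hε : 0 < ε) (hg : AnalyticOnNhd ℝ g (strip ε))
    (h : ∀ t ∈ Icc (-t₀) t₀, ∀ x, |g (t, x)| ≤ C * |t| ^ n) : VanishesToOrder n g := by
  intro j hj x
  have h0 : (0 : ℝ) ∈ Ioo (-ε) ε := ⟨by simpa using hε, hε⟩
  have ha := analyticAt_time (hg (0, x) ⟨h0, mem_univ _⟩)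
  rw [← iteratedDeriv_time hg x j h0]
  refine (natCast_le_analyticOrderAt_iff_iteratedDeriv_eq_zero ha).1
    (natCast_le_analyticOrderAt_of_bound ha (C := C) ?_) j hj
  filter_upwards [Icc_mem_nhds (by linarith : -t₀ < 0) ht₀] with t ht using h t ht x

theorem greenOp_sub {f g : ℝ → ℝ} (hf : Continuous f) (hg : Continuous g) (x : ℝ) :
    greenOp f x - greenOp g x = greenOp (fun y => f y - g y) x := by
  rw [greenOp, greenOp, greenOp, ← mul_sub, ← intervalIntegral.integral_sub
    ((by fun_prop : Continuous fun y => Real.cosh (y - 1 / 2) * f (x + y)).intervalIntegrable _ _)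
    ((by fun_prop : Continuous fun y => Real.cosh (y - 1 / 2) * g (x + y)).intervalIntegrable _ _)]
  simp only [mul_sub]

theorem abs_mul_mul_sub_le {a b c a' b' c' A η : ℝ} (hb : |b| ≤ A) (hc : |c| ≤ A)
    (ha' : |a'| ≤ A) (hb' : |b'| ≤ A) (h1 : |a - a'| ≤ η) (h2 : |b - b'| ≤ η)
    (h3 : |c - c'| ≤ η) : |a * b * c - a' * b' * c'| ≤ 3 * A ^ 2 * η := by
  have hA : 0 ≤ A := (abs_nonneg _).trans hb
  have hη : 0 ≤ η := (abs_nonneg _).trans h1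
  calc |a * b * c - a' * b' * c'|
      = |(a - a') * b * c + a' * (b - b') * c + a' * b' * (c - c')| := by congr 1; ring
    _ ≤ |(a - a') * b * c| + |a' * (b - b') * c| + |a' * b' * (c - c')| := abs_add_three _ _ _
    _ ≤ η * A * A + A * η * A + A * A * η := by
        simp only [abs_mul]
        gcongr
    _ = 3 * A ^ 2 * η := by ring

/-- The lift to the plane of a function on space-time. -/
def planeLift (u : ℝ → UnitAddCircle → ℝ) (p : ℝ × ℝ) : ℝ := u p.1 (p.2 : UnitAddCircle)

theorem periodic_planeLift (u : ℝ → UnitAddCircle → ℝ) : Function.Periodic (planeLift u) (0, 1) :=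
  fun p => by simp [planeLift]

section Solution

variable {u : ℝ → UnitAddCircle → ℝ} {ε t : ℝ}

theorem circleDeriv_planeLift (hu : AnalyticOnNhd ℝ (planeLift u) (strip ε))
    (ht : t ∈ Ioo (-ε) ε) (x : ℝ) : circleDeriv (u t) x = dirDeriv (0, 1) (planeLift u) (t, x) := by
  rw [circleDeriv_coe]
  exact (hasDerivAt_space (hu (t, x) ⟨ht, mem_univ _⟩)).deriv

theorem circleDeriv_circleDeriv_planeLift (hu : AnalyticOnNhd ℝ (planeLift u) (strip ε))
    (ht : t ∈ Ioo (-ε) ε) (x : ℝ) : circleDeriv (circleDeriv (u t)) x =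
      dirDeriv (0, 1) (dirDeriv (0, 1) (planeLift u)) (t, x) := by
  rw [circleDeriv_coe, funext (circleDeriv_planeLift hu ht)]
  exact (hasDerivAt_space (hu.dirDeriv _ (t, x) ⟨ht, mem_univ _⟩)).deriv

theorem novikovSource_planeLift (hu : AnalyticOnNhd ℝ (planeLift u) (strip ε))
    (ht : t ∈ Ioo (-ε) ε) (x : ℝ) : novikovSource (u t) x =
      3 * planeLift u (t, x) ^ 2 * dirDeriv (0, 1) (planeLift u) (t, x)
        + 2 * dirDeriv (0, 1) (planeLift u) (t, x) ^ 3
        + 3 * planeLift u (t, x) * dirDeriv (0, 1) (planeLift u) (t, x) *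
          dirDeriv (0, 1) (dirDeriv (0, 1) (planeLift u)) (t, x) := by
  rw [novikovSource, circleDeriv_circleDeriv_planeLift hu ht, circleDeriv_planeLift hu ht]
  rfl

theorem analyticOnNhd_novikovSource (hu : AnalyticOnNhd ℝ (planeLift u) (strip ε))
    (ht : t ∈ Ioo (-ε) ε) : AnalyticOnNhd ℝ (fun x : ℝ => novikovSource (u t) x) univ := by
  rw [funext (novikovSource_planeLift hu ht)]
  intro x _
  have h0 := analyticAt_space (hu (t, x) ⟨ht, mem_univ _⟩)
  have h1 := analyticAt_space (hu.dirDeriv (0, 1) (t, x) ⟨ht, mem_univ _⟩)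
  have h2 := analyticAt_space ((hu.dirDeriv (0, 1)).dirDeriv (0, 1) (t, x) ⟨ht, mem_univ _⟩)
  exact (((analyticAt_const.mul (h0.pow 2)).mul h1).add (analyticAt_const.mul (h1.pow 3))).add
    (((analyticAt_const.mul h0).mul h1).mul h2)

theorem dirDeriv_time_planeLift {u₀ : UnitAddCircle → ℝ}
    (hu : IsAnalyticNovikovSolution u₀ ε u) (ht : t ∈ Ioo (-ε) ε) (x : ℝ) :
    dirDeriv (1, 0) (planeLift u) (t, x) =
      -(planeLift u (t, x) * planeLift u (t, x) * dirDeriv (0, 1) (planeLift u) (t, x)) -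
        greenOp (fun y : ℝ => novikovSource (u t) y) x := by
  have ha : AnalyticOnNhd ℝ (planeLift u) (strip ε) := hu.analytic
  have he := hu.equation t ht x
  rw [circleDeriv_planeLift ha ht, invLambdaSq_eq_greenOp
    (analyticOnNhd_novikovSource ha ht).contDiff] at he
  have hd : deriv (fun τ : ℝ => u τ x) t = dirDeriv (1, 0) (planeLift u) (t, x) :=
    (hasDerivAt_time (ha (t, x) ⟨ht, mem_univ _⟩)).deriv
  have hv : planeLift u (t, x) = u t x := rfl
  rw [hd] at he
  rw [hv]
  linarith

end Solution

/-- The right-hand side of the Novikov equation is Lipschitz in `(u, uₓ, uₓₓ)` for the supremum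
norm in space. -/
theorem exists_dirDeriv_time_sub_bound {u₀ : UnitAddCircle → ℝ} {u v : ℝ → UnitAddCircle → ℝ}
    {ε t₀ : ℝ} (ht₀ : 0 < t₀) (htε : t₀ < ε) (hu : IsAnalyticNovikovSolution u₀ ε u)
    (hv : IsAnalyticNovikovSolution u₀ ε v) :
    ∃ A : ℝ, ∀ t ∈ Icc (-t₀) t₀, ∀ η : ℝ,
      (∀ x, |planeLift u (t, x) - planeLift v (t, x)| ≤ η) →
      (∀ x, |dirDeriv (0, 1) (planeLift u) (t, x) - dirDeriv (0, 1) (planeLift v) (t, x)| ≤ η) →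
      (∀ x, |dirDeriv (0, 1) (dirDeriv (0, 1) (planeLift u)) (t, x) -
        dirDeriv (0, 1) (dirDeriv (0, 1) (planeLift v)) (t, x)| ≤ η) →
      ∀ x, |dirDeriv (1, 0) (planeLift u) (t, x) - dirDeriv (1, 0) (planeLift v) (t, x)| ≤
        A * η := by
  have bdd : ∀ w : ℝ → UnitAddCircle → ℝ, AnalyticOnNhd ℝ (planeLift w) (strip ε) →
      ∃ A : ℝ, ∀ t ∈ Icc (-t₀) t₀, ∀ x, |planeLift w (t, x)| ≤ A ∧
        |dirDeriv (0, 1) (planeLift w) (t, x)| ≤ A ∧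
        |dirDeriv (0, 1) (dirDeriv (0, 1) (planeLift w)) (t, x)| ≤ A := by
    intro w hw
    have hp := periodic_planeLift w
    have h0 : ∀ g, VanishesToOrder 0 g := fun g j hj => absurd hj (by omega)
    obtain ⟨A, -, hA⟩ := (h0 _).exists_bound ht₀ htε hw hp
    obtain ⟨B, -, hB⟩ := (h0 _).exists_bound ht₀ htε (hw.dirDeriv (0, 1)) (hp.dirDeriv _)
    obtain ⟨C, -, hC⟩ := (h0 _).exists_bound ht₀ htε ((hw.dirDeriv (0, 1)).dirDeriv (0, 1))
      ((hp.dirDeriv _).dirDeriv _)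
    simp only [pow_zero, mul_one] at hA hB hC
    exact ⟨max A (max B C), fun t ht x => ⟨(hA t ht x).trans (le_max_left _ _),
      (hB t ht x).trans ((le_max_left _ _).trans (le_max_right _ _)),
      (hC t ht x).trans ((le_max_right _ _).trans (le_max_right _ _))⟩⟩
  have hua : AnalyticOnNhd ℝ (planeLift u) (strip ε) := hu.analytic
  have hva : AnalyticOnNhd ℝ (planeLift v) (strip ε) := hv.analytic
  obtain ⟨A₁, hA₁⟩ := bdd u hua
  obtain ⟨A₂, hA₂⟩ := bdd v hva
  set A := max A₁ A₂
  refine ⟨27 * A ^ 2, fun t ht η h0 h1 h2 => ?_⟩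
  have htI : t ∈ Ioo (-ε) ε := ⟨by linarith [ht.1], by linarith [ht.2]⟩
  have hu' : ∀ x, |planeLift u (t, x)| ≤ A ∧ |dirDeriv (0, 1) (planeLift u) (t, x)| ≤ A ∧
      |dirDeriv (0, 1) (dirDeriv (0, 1) (planeLift u)) (t, x)| ≤ A := fun x =>
    ⟨(hA₁ t ht x).1.trans (le_max_left _ _), (hA₁ t ht x).2.1.trans (le_max_left _ _),
      (hA₁ t ht x).2.2.trans (le_max_left _ _)⟩
  have hv' : ∀ x, |planeLift v (t, x)| ≤ A ∧ |dirDeriv (0, 1) (planeLift v) (t, x)| ≤ A ∧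
      |dirDeriv (0, 1) (dirDeriv (0, 1) (planeLift v)) (t, x)| ≤ A := fun x =>
    ⟨(hA₂ t ht x).1.trans (le_max_right _ _), (hA₂ t ht x).2.1.trans (le_max_right _ _),
      (hA₂ t ht x).2.2.trans (le_max_right _ _)⟩
  have hS : ∀ x : ℝ, |novikovSource (u t) x - novikovSource (v t) x| ≤ 24 * A ^ 2 * η := by
    intro x
    rw [novikovSource_planeLift hua htI, novikovSource_planeLift hva htI]
    obtain ⟨u0, u1, u2⟩ := hu' x
    obtain ⟨v0, v1, v2⟩ := hv' x
    have p1 := abs_mul_mul_sub_le u0 u1 v0 v0 (h0 x) (h0 x) (h1 x)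
    have p2 := abs_mul_mul_sub_le u1 u1 v1 v1 (h1 x) (h1 x) (h1 x)
    have p3 := abs_mul_mul_sub_le u1 u2 v0 v1 (h0 x) (h1 x) (h2 x)
    rw [abs_le] at p1 p2 p3 ⊢
    constructor <;> nlinarith [p1.1, p1.2, p2.1, p2.2, p3.1, p3.2]
  intro x
  rw [dirDeriv_time_planeLift hu htI, dirDeriv_time_planeLift hv htI]
  have p1 := abs_mul_mul_sub_le (hu' x).1 (hu' x).2.1 (hv' x).1 (hv' x).1 (h0 x) (h0 x) (h1 x)
  have p2 := abs_greenOp_le hS x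
  rw [← greenOp_sub (continuousOn_univ.1 (analyticOnNhd_novikovSource hua htI).continuousOn)
    (continuousOn_univ.1 (analyticOnNhd_novikovSource hva htI).continuousOn)] at p2
  rw [abs_le] at p1 p2 ⊢
  constructor <;> linarith [p1.1, p1.2, p2.1, p2.2]

theorem dirDeriv_sub {g h : ℝ × ℝ → ℝ} {p : ℝ × ℝ} (hg : AnalyticAt ℝ g p) (hh : AnalyticAt ℝ h p)
    (v : ℝ × ℝ) : dirDeriv v (g - h) p = dirDeriv v g p - dirDeriv v h p := by
  rw [dirDeriv, fderiv_sub hg.differentiableAt hh.differentiableAt]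
  rfl

/-- The difference of two solutions with the same initial value vanishes to infinite order at
time `0`: if it vanishes to order `n`, so do its space derivatives, hence, by the equation, its
time derivative. -/
theorem vanishesToOrder_sub {u₀ : UnitAddCircle → ℝ} {u v : ℝ → UnitAddCircle → ℝ} {ε : ℝ}
    (hε : 0 < ε) (hu : IsAnalyticNovikovSolution u₀ ε u) (hv : IsAnalyticNovikovSolution u₀ ε v)
    (n : ℕ) : VanishesToOrder n (planeLift u - planeLift v) := by
  have hua : AnalyticOnNhd ℝ (planeLift u) (strip ε) := hu.analytic
  have hva : AnalyticOnNhd ℝ (planeLift v) (strip ε) := hv.analytic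
  set w := planeLift u - planeLift v with hw
  have hwa : AnalyticOnNhd ℝ w (strip ε) := hua.sub hva
  have hwp : Function.Periodic w (0, 1) := (periodic_planeLift u).sub (periodic_planeLift v)
  have ht₀ : 0 < ε / 2 := half_pos hε
  have htε : ε / 2 < ε := half_lt_self hε
  have d1 : EqOn (dirDeriv (0, 1) w)
      (dirDeriv (0, 1) (planeLift u) - dirDeriv (0, 1) (planeLift v)) (strip ε) := fun p hp =>
    dirDeriv_sub (hua p hp) (hva p hp) _
  have d2 : EqOn (dirDeriv (0, 1) (dirDeriv (0, 1) w))
      (dirDeriv (0, 1) (dirDeriv (0, 1) (planeLift u)) -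
        dirDeriv (0, 1) (dirDeriv (0, 1) (planeLift v))) (strip ε) := fun p hp => by
    refine Eq.trans ?_ (dirDeriv_sub (hua.dirDeriv (0, 1) p hp) (hva.dirDeriv (0, 1) p hp) _)
    exact congrArg (fun L : ℝ × ℝ →L[ℝ] ℝ => L (0, 1))
      (Filter.EventuallyEq.fderiv_eq (d1.eventuallyEq_of_mem ((isOpen_strip ε).mem_nhds hp)))
  obtain ⟨A, hA⟩ := exists_dirDeriv_time_sub_bound ht₀ htε hu hv
  induction n with
  | zero => exact fun j hj => absurd hj (by omega)
  | succ n ih =>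
    have v1 := ih.dirDeriv_space hε hwa
    have v2 := v1.dirDeriv_space hε (hwa.dirDeriv _)
    obtain ⟨C₀, p0, hC₀⟩ := ih.exists_bound ht₀ htε hwa hwp
    obtain ⟨C₁, p1, hC₁⟩ := v1.exists_bound ht₀ htε (hwa.dirDeriv _) (hwp.dirDeriv _)
    obtain ⟨C₂, p2, hC₂⟩ := v2.exists_bound ht₀ htε ((hwa.dirDeriv _).dirDeriv _)
      ((hwp.dirDeriv _).dirDeriv _)
    have vt : VanishesToOrder n (dirDeriv (1, 0) w) := by
      refine vanishesToOrder_of_bound (C := A * (C₀ + C₁ + C₂)) ht₀ hε (hwa.dirDeriv _)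
        fun t ht x => ?_
      have hts : ∀ y, (t, y) ∈ strip ε := fun y =>
        ⟨⟨by linarith [ht.1], by linarith [ht.2]⟩, mem_univ _⟩
      have hpow : 0 ≤ |t| ^ n := by positivity
      rw [dirDeriv_sub (hua _ (hts x)) (hva _ (hts x)), mul_assoc]
      refine hA t ht ((C₀ + C₁ + C₂) * |t| ^ n) (fun y => ?_) (fun y => ?_) (fun y => ?_) x
      · exact (hC₀ t ht y).trans (by gcongr; linarith)
      · have := hC₁ t ht y
        rw [d1 (hts y)] at this
        exact this.trans (by gcongr; linarith)
      · have := hC₂ t ht y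
        rw [d2 (hts y)] at this
        exact this.trans (by gcongr; linarith)
    intro j hj x
    rcases j with _ | j
    · change u 0 x - v 0 x = 0
      rw [hu.initial, hv.initial, sub_self]
    · rw [Function.iterate_succ_apply]
      exact vt j (by omega) x

theorem IsAnalyticNovikovSolution.eq {u₀ : UnitAddCircle → ℝ} {u v : ℝ → UnitAddCircle → ℝ} {ε : ℝ}
    (hu : IsAnalyticNovikovSolution u₀ ε u) (hv : IsAnalyticNovikovSolution u₀ ε v) {t : ℝ}
    (ht : t ∈ Ioo (-ε) ε) (x : UnitAddCircle) : u t x = v t x := by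
  have hε : 0 < ε := by linarith [ht.1, ht.2]
  induction x using QuotientAddGroup.induction_on with
  | H x =>
    have hwa : AnalyticOnNhd ℝ (planeLift u - planeLift v) (strip ε) := hu.analytic.sub hv.analytic
    have h0 : (0 : ℝ) ∈ Ioo (-ε) ε := ⟨by simpa using hε, hε⟩
    have ha : AnalyticOnNhd ℝ (fun τ => (planeLift u - planeLift v) (τ, x)) (Ioo (-ε) ε) :=
      fun τ hτ => analyticAt_time (hwa (τ, x) ⟨hτ, mem_univ _⟩)
    have htop : analyticOrderAt (fun τ => (planeLift u - planeLift v) (τ, x)) 0 = ⊤ := by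
      refine ENat.eq_top_iff_forall_ge.2 fun n => ?_
      rw [natCast_le_analyticOrderAt_iff_iteratedDeriv_eq_zero (ha 0 h0)]
      intro j hj
      rw [iteratedDeriv_time hwa x j h0]
      exact vanishesToOrder_sub hε hu hv n j hj x
    exact sub_eq_zero.1 (ha.eqOn_zero_of_preconnected_of_eventuallyEq_zero isPreconnected_Ioo h0
      (analyticOrderAt_eq_top.1 htop) ht)

end Uniqueness

end

theorem theorem4 (u₀ : UnitAddCircle → ℝ) (hu₀ : CircleAnalytic u₀) :
    ∃ ε : ℝ, 0 < ε ∧ ∃ u : ℝ → UnitAddCircle → ℝ,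
      IsAnalyticNovikovSolution u₀ ε u ∧
      ∀ v : ℝ → UnitAddCircle → ℝ, IsAnalyticNovikovSolution u₀ ε v →
        ∀ t ∈ Set.Ioo (-ε) ε, ∀ x : UnitAddCircle, v t x = u t x := by
  obtain ⟨ε, hε, u, hu⟩ := exists_isAnalyticNovikovSolution hu₀
  exact ⟨ε, hε, u, hu, fun v hv t ht x => hv.eq hu ht x⟩
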